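/- For integers $1\le p\le n-1$ let $\mathrm{St}(n,p)=\{X\in\mathbb{R}^{n\times p} : X^\top X=I_p\}$ be the Stiefel manifold, with tangent spaces $\mathrm{T}_X\mathrm{St}(n,p)=\{\xi\in\mathbb{R}^{n\times p} : X^\top\xi+\xi^\top X=0\}$. For $\beta>0$ endow it with the Riemannian metric \[ g_X(\xi,\eta)=\beta\,\mathrm{tr}\big((X^\top\xi)^\top X^\top\eta\big)+\mathrm{tr}\big(\xi^\top(I_n-XX^\top)\eta\big),\qquad \xi,\eta\in\mathrm{T}_X\mathrm{St}(n,p); \] equivalently, $g_X(\xi_{\mathrm a},\xi_{\mathrm b})=\beta\,\mathrm{tr}(A_{\mathrm a}^\top A_{\mathrm b})+\mathrm{tr}(H_{\mathrm a}^\top H_{\mathrm b})$ for $\xi_i=XA_i+X_\perp H_i$, where $[X\ X_\perp]$ is orthogonal. The metric with $\beta=\tfrac12$ is the canonical metric and the metric with $\beta=1$ is the Euclidean metric. Let $d$ be the Riemannian distance. For a unit tangent vector $\xi$ at $X$ let $\gamma_\xi$ be the geodesic with $\gamma_\xi(0)=X$ and $\gamma_\xi'(0)=\xi$, and let $t_{\mathrm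 c}(\xi)=\sup\{t>0 : d(X,\gamma_\xi(t))=t\}$ be its cut time. The injectivity radius $\mathrm{inj}_{\mathrm{St}(n,p)}$ is the infimum of $t_{\mathrm c}(\xi)$ over all $X\in\mathrm{St}(n,p)$ and all unit tangent vectors $\xi$ at $X$. Then the following hold. 1. The equation $\frac{\sin t}{t}+\cos t=0$ has a smallest positive solution $t^{\mathrm r}$, and $t^{\mathrm r}\sqrt2\approx 0.91326189159122\,\pi$ (the error of the coefficient of $\pi$ is at most $5\cdot10^{-15}$). For all $n,p$ with $2\le p\le n-2$, in the canonical metric, \[ \mathrm{inj}_{\mathrm{St}(n,p)}\le t^{\mathrm r}\sqrt2 . \] 2. For all $n,p$ with $2\le p\le n-2$, in the Euclidean metric, $\mathrm{inj}_{\mathrm{St}(n,p)}\le\pi$. 3. For all $n\ge2$ and $p=n-1$, $\mathrm{inj}_{\mathrm{St}(n,n-1)}=\pi$ in the canonical metric and $\mathrm{inj}_{\mathrm{St}(n,n-1)}\le\pi$ in the Euclidean metric. 4. For all $n\ge2$ and $p=1$, $\mathrm{inj}_{\mathrm{St}(n,1)}=\pi$ in the metric with any parameter $\beta>0$. -/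

import Mathlib

open scoped Matrix ContDiff ENNReal

noncomputable section

namespace Stiefel

/- The ambient vector space of real matrices, normed by the Frobenius norm.  The norm is only
used to speak of smoothness and of derivatives, for which all norms are equivalent. -/
attribute [local instance] Matrix.frobeniusNormedAddCommGroup Matrix.frobeniusNormedSpace

/-- The Stiefel manifold `St(n,p)` of orthonormal `p`-frames in `ℝⁿ`. -/
def manifold (n p : ℕ) : Set (Matrix (Fin n) (Fin p) ℝ) :=
  {X | Xᵀ * X = 1}

/-- The tangent space of `St(n,p)` at `X`. -/
def tangentSpace {n p : ℕ} (X : Matrix (Fin n) (Fin p) ℝ) :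
    Set (Matrix (Fin n) (Fin p) ℝ) :=
  {ξ | Xᵀ * ξ + ξᵀ * X = 0}

/-- The metric with parameter `β`:
`g_X(ξ, η) = β tr((Xᵀ ξ)ᵀ (Xᵀ η)) + tr(ξᵀ (I - X Xᵀ) η)`.
`β = 1/2` is the canonical metric and `β = 1` is the Euclidean metric.  For tangent vectors
`ξ = X A + X⊥ H` and `η = X A' + X⊥ H'` this is `β tr(Aᵀ A') + tr(Hᵀ H')`, see `metric_blocks`.
The same formula is defined for all matrices, and for `X` near `St(n,p)` and `β > 0` it is an inner
product on the ambient space; `IsGeodesic` uses this extension. -/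
def metric {n p : ℕ} (β : ℝ) (X ξ η : Matrix (Fin n) (Fin p) ℝ) : ℝ :=
  β * ((Xᵀ * ξ)ᵀ * (Xᵀ * η)).trace + (ξᵀ * (1 - X * Xᵀ) * η).trace

/-- The metric in terms of the decomposition of tangent vectors by an orthogonal matrix `[X Y]`. -/
theorem metric_blocks {n p m : ℕ} (β : ℝ) (X : Matrix (Fin n) (Fin p) ℝ)
    (Y : Matrix (Fin n) (Fin m) ℝ) (hX : Xᵀ * X = 1) (hY : Yᵀ * Y = 1) (hXY : Xᵀ * Y = 0)
    (A A' : Matrix (Fin p) (Fin p) ℝ) (H H' : Matrix (Fin m) (Fin p) ℝ) :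
    metric β X (X * A + Y * H) (X * A' + Y * H') =
      β * (Aᵀ * A').trace + (Hᵀ * H').trace := by
  have e : ∀ (B : Matrix (Fin p) (Fin p) ℝ) (K : Matrix (Fin m) (Fin p) ℝ),
      Xᵀ * (X * B + Y * K) = B := by
    intro B K
    rw [Matrix.mul_add, ← Matrix.mul_assoc, ← Matrix.mul_assoc, hX, hXY]
    simp
  have e2 : (1 - X * Xᵀ) * (X * A' + Y * H') = Y * H' := by
    rw [Matrix.sub_mul, Matrix.mul_assoc, e]
    simp
  have hYX : Yᵀ * X = 0 := by
    have h := congrArg Matrix.transpose hXY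
    simpa using h
  have e3 : (X * A + Y * H)ᵀ * (Y * H') = Hᵀ * H' := by
    rw [Matrix.transpose_add, Matrix.transpose_mul, Matrix.transpose_mul, Matrix.add_mul,
      Matrix.mul_assoc, ← Matrix.mul_assoc Xᵀ, hXY, Matrix.mul_assoc, ← Matrix.mul_assoc Yᵀ, hY]
    simp
  rw [metric, e, e, Matrix.mul_assoc, e2, e3]

/-- Piecewise `C¹` curves `[0,1] → St(n,p)`: continuous curves for which there is a finite set of
breakpoints such that the curve is `C¹` on every closed subinterval of `[0,1]` without breakpoints
in its interior. -/
def IsPiecewiseC1Curve {n p : ℕ} (c : ℝ → Matrix (Fin n) (Fin p) ℝ) : Prop :=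
  ContinuousOn c (Set.Icc 0 1) ∧ (∀ t ∈ Set.Icc (0 : ℝ) 1, c t ∈ manifold n p) ∧
    ∃ S : Finset ℝ, ∀ a b : ℝ, 0 ≤ a → a < b → b ≤ 1 →
      (∀ s ∈ S, s ∉ Set.Ioo a b) → ContDiffOn ℝ 1 c (Set.Icc a b)

/-- The length of a piecewise `C¹` curve `[0,1] → St(n,p)`.  (The derivative exists outside a finite
set, which does not affect the integral.) -/
def curveLength {n p : ℕ} (β : ℝ) (c : ℝ → Matrix (Fin n) (Fin p) ℝ) : ℝ :=
  ∫ t in (0 : ℝ)..1, √(metric β (c t) (deriv c t) (deriv c t))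

/-- The Riemannian distance on `St(n,p)`: the infimum of the lengths of the piecewise `C¹` curves
from `X` to `Y` (and `∞` if there is none). -/
def riemannianDist {n p : ℕ} (β : ℝ) (X Y : Matrix (Fin n) (Fin p) ℝ) : ℝ≥0∞ :=
  ⨅ (c : ℝ → Matrix (Fin n) (Fin p) ℝ) (_ : IsPiecewiseC1Curve c ∧ c 0 = X ∧ c 1 = Y),
    ENNReal.ofReal (curveLength β c)

/-- The derivative, at the base point `X` in the direction `ζ`, of the metric coefficient
`X ↦ g_X(ξ, η)`, for constant `ξ` and `η`. -/
def metricDeriv {n p : ℕ} (β : ℝ) (X ζ ξ η : Matrix (Fin n) (Fin p) ℝ) : ℝ :=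
  fderiv ℝ (fun Z => metric β Z ξ η) X ζ

/-- `g(∇_{γ'} γ', η)` at time `t`, where `∇` is the Levi-Civita connection of the metric on the
ambient space, written out in the linear coordinates of that space (Christoffel symbols of the
first kind): `g(γ'', η) + (D_{γ'} g)(γ', η) - (D_η g)(γ', γ') / 2`.
Since the Levi-Civita connection of a submanifold with the induced metric is the tangential part of
the ambient one, for `η` tangent to `St(n,p)` at `γ t` this is also
`g(∇_{γ'} γ', η)` for the Levi-Civita connection of `St(n,p)`. -/
def covariantAcceleration {n p : ℕ} (β : ℝ) (γ : ℝ → Matrix (Fin n) (Fin p) ℝ) (t : ℝ)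
    (η : Matrix (Fin n) (Fin p) ℝ) : ℝ :=
  metric β (γ t) (deriv (deriv γ) t) η
    + metricDeriv β (γ t) (deriv γ t) (deriv γ t) η
    - metricDeriv β (γ t) η (deriv γ t) (deriv γ t) / 2

/-- Geodesics `ℝ → St(n,p)`: smooth curves in `St(n,p)` with `∇_{γ'} γ' = 0`. -/
def IsGeodesic {n p : ℕ} (β : ℝ) (γ : ℝ → Matrix (Fin n) (Fin p) ℝ) : Prop :=
  ContDiff ℝ ∞ γ ∧ (∀ t, γ t ∈ manifold n p) ∧
    ∀ t, ∀ η ∈ tangentSpace (γ t), covariantAcceleration β γ t η = 0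

/-- The cut time `sup {t > 0 | d(γ 0, γ t) = t}` of a unit-speed geodesic. -/
def cutTime {n p : ℕ} (β : ℝ) (γ : ℝ → Matrix (Fin n) (Fin p) ℝ) : ℝ≥0∞ :=
  ⨆ (t : ℝ) (_ : 0 < t ∧ riemannianDist β (γ 0) (γ t) = ENNReal.ofReal t), ENNReal.ofReal t

/-- The injectivity radius at `X`: the infimum of the cut times of the geodesics that start at `X`
with a unit tangent vector as initial velocity.  (As `St(n,p)` is complete, there is exactly one
geodesic `γ : ℝ → St(n,p)` for each such `ξ`.) -/
def injRadiusAt {n p : ℕ} (β : ℝ) (X : Matrix (Fin n) (Fin p) ℝ) : ℝ≥0∞ :=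
  ⨅ (ξ : Matrix (Fin n) (Fin p) ℝ) (_ : ξ ∈ tangentSpace X ∧ metric β X ξ ξ = 1)
    (γ : ℝ → Matrix (Fin n) (Fin p) ℝ) (_ : IsGeodesic β γ ∧ γ 0 = X ∧ deriv γ 0 = ξ),
    cutTime β γ

/-- The injectivity radius of `St(n,p)` with the metric of parameter `β`. -/
def injRadius (β : ℝ) (n p : ℕ) : ℝ≥0∞ :=
  ⨅ X ∈ manifold n p, injRadiusAt β X

end Stiefel

end

namespace Stiefel

/-! Each upper bound comes from one explicit geodesic and a competing curve: if arbitrarily soon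
after `b` some curve to `γ t` is shorter than `t`, no later point can be at distance equal to its
time (`cutTime_le`). Rotating one column of a frame into a direction orthogonal to all columns
gives, for every `β`, a closed unit-speed geodesic of length `2π`; going the other way round wins
after `π`, hence `Block.injRadius_le_pi`.

For the canonical metric and `2 ≤ p ≤ n - 2`, two columns are rotated at once into two new
directions. This geodesic lies in a squashed three-sphere of frames `P (x₀ + x₁ J) + N (x₂ + x₃ J) +
R`, on which the Hopf fibres are shortened. A horizontal arc of angle `θ` has length `√2 θ`. It
competes with orbits that carry a small Hopf twist `κ`, whose squared length differs from `2 θ²` by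
`κ² (1 - (θ cot θ)²) + o(κ²)`. This is negative once `θ cot θ < -1`, that is `sin θ + θ cos θ < 0`
(`exists_shorter_orbit`).

The lower bounds are calibrations: a function that grows along any curve at most as fast as arc
length, but by `π` along the given geodesic on `[0, π]` (`sub_le_curveLength`, `le_cutTime`). For `p
= 1` it is the spherical distance from the starting point. For `p = n - 1`, completing frames by
their normal identifies the manifold with the rotation group, and the canonical metric with half the
squared Frobenius norm of the angular velocity. Geodesics have constant angular velocity `M`
(`IsGeodesic.momentum_eq`). With an orthonormal eigenbasis `u j` of `Mᵀ M` and eigenvalues `l j`,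
the calibration is `∑ (√(l j) / 2) arccos ⟨u j, S u j⟩`: Cauchy–Schwarz bounds its growth, and `∑ l
j = 2` makes it equal `π` at time `π`, provided no angle `√(l j) π` exceeds `π`. That holds because
nonzero singular values of a skew matrix come in pairs. Since `arccos` is not differentiable at
`±1`, both calibrations use `arccos (r q)` with `r < 1` and then let `r` tend to `1`. -/

/-! ### The first positive root of `sin t + t cos t`, numerically. -/

open Finset in
theorem sum_mul_I_pow_div_factorial (x : ℝ) (m : ℕ) :
    ∑ j ∈ range (2 * m), ((x : ℂ) * Complex.I) ^ j / (j.factorial : ℂ) =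
      ((∑ k ∈ range m, (-1) ^ k * x ^ (2 * k) / ((2 * k).factorial : ℝ) : ℝ) : ℂ) +
      ((∑ k ∈ range m, (-1) ^ k * x ^ (2 * k + 1) / ((2 * k + 1).factorial : ℝ) : ℝ) : ℂ)
        * Complex.I := by
  induction m with
  | zero => simp
  | succ m ih =>
    rw [show 2 * (m + 1) = 2 * m + 1 + 1 by ring, sum_range_succ, sum_range_succ, ih,
      sum_range_succ _ m, sum_range_succ _ m]
    have h1 : ((x : ℂ) * Complex.I) ^ (2 * m) = (-1) ^ m * (x : ℂ) ^ (2 * m) := by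
      rw [mul_pow, pow_mul Complex.I, Complex.I_sq]; ring
    rw [pow_succ ((x : ℂ) * Complex.I), h1]
    push_cast
    ring

-- Real and imaginary parts of the Taylor remainder of the exponential at `x i`.
open Finset in
theorem taylor_cos_sin_bound (x : ℝ) (m : ℕ) (hx : |x| / ((2 * m).succ : ℝ) ≤ 1 / 2) :
    |Real.cos x - ∑ k ∈ range m, (-1) ^ k * x ^ (2 * k) / ((2 * k).factorial : ℝ)| ≤
        |x| ^ (2 * m) / ((2 * m).factorial : ℝ) * 2 ∧
    |Real.sin x - ∑ k ∈ range m, (-1) ^ k * x ^ (2 * k + 1) / ((2 * k + 1).factorial : ℝ)| ≤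
        |x| ^ (2 * m) / ((2 * m).factorial : ℝ) * 2 := by
  have hn : ‖(x : ℂ) * Complex.I‖ = |x| := by simp
  have h := Complex.exp_bound' (x := (x : ℂ) * Complex.I) (n := 2 * m) (by rw [hn]; exact hx)
  rw [hn, sum_mul_I_pow_div_factorial, Complex.exp_mul_I, ← Complex.ofReal_cos,
    ← Complex.ofReal_sin] at h
  constructor
  · refine le_trans (le_of_eq ?_) ((Complex.abs_re_le_norm _).trans h)
    simp only [Complex.sub_re, Complex.add_re, Complex.mul_re, Complex.ofReal_re, Complex.ofReal_im,
      Complex.I_re, Complex.I_im, mul_zero, zero_mul, sub_zero, add_zero]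
  · refine le_trans (le_of_eq ?_) ((Complex.abs_im_le_norm _).trans h)
    simp only [Complex.sub_im, Complex.add_im, Complex.mul_im, Complex.ofReal_re, Complex.ofReal_im,
      Complex.I_re, Complex.I_im, mul_zero, mul_one, zero_add, add_zero]

/-- `t ↦ sin t + t cos t`, whose smallest positive zero governs the cut time of the canonical
metric. -/
noncomputable def conjFun (t : ℝ) : ℝ := Real.sin t + t * Real.cos t

theorem continuous_conjFun : Continuous conjFun := by
  unfold conjFun; fun_prop

theorem conjFun_pos_of_le_pi_div_two {t : ℝ} (h0 : 0 < t) (h1 : t ≤ Real.pi / 2) :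
    0 < conjFun t := by
  have hs : 0 < Real.sin t := Real.sin_pos_of_pos_of_lt_pi h0 (by linarith [Real.pi_pos])
  have hc : 0 ≤ Real.cos t := Real.cos_nonneg_of_mem_Icc ⟨by linarith, h1⟩
  unfold conjFun
  positivity

/-- The derivative is `2 cos t - t sin t`, and both terms are negative between `π / 2` and `π`. -/
theorem strictAntiOn_conjFun : StrictAntiOn conjFun (Set.Icc (Real.pi / 2) Real.pi) := by
  refine strictAntiOn_of_deriv_neg (convex_Icc _ _) continuous_conjFun.continuousOn ?_
  intro t ht
  rw [interior_Icc] at ht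
  have hd : HasDerivAt conjFun (Real.cos t + (1 * Real.cos t + t * (-Real.sin t))) t :=
    (Real.hasDerivAt_sin t).add ((hasDerivAt_id t).mul (Real.hasDerivAt_cos t))
  rw [hd.deriv]
  have hp := Real.pi_pos
  have hc : Real.cos t < 0 := Real.cos_neg_of_pi_div_two_lt_of_lt ht.1 (by linarith [ht.2])
  have hs : 0 < Real.sin t := Real.sin_pos_of_pos_of_lt_pi (by linarith [ht.1]) ht.2
  have : 0 < t * Real.sin t := mul_pos (by linarith [ht.1]) hs
  linarith

theorem conjFun_lower : 0 < conjFun 2.02875783811043 := by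
  -- With fifteen terms the remainder `2 x³⁰ / 30!` is below `10⁻²²`, negligible against the bracket
  -- width `10⁻¹⁴`.
  obtain ⟨hc, hs⟩ := taylor_cos_sin_bound 2.02875783811043 15 (by norm_num [abs_of_pos])
  rw [abs_of_pos (by norm_num : (0 : ℝ) < 2.02875783811043)] at hc hs
  unfold conjFun
  rw [abs_le] at hc hs
  norm_num [Finset.sum_range_succ, Nat.factorial] at hc hs
  norm_num
  linarith [hc.1, hs.1]

theorem conjFun_upper : conjFun 2.02875783811044 < 0 := by
  obtain ⟨hc, hs⟩ := taylor_cos_sin_bound 2.02875783811044 15 (by norm_num [abs_of_pos])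
  rw [abs_of_pos (by norm_num : (0 : ℝ) < 2.02875783811044)] at hc hs
  unfold conjFun
  rw [abs_le] at hc hs
  norm_num [Finset.sum_range_succ, Nat.factorial] at hc hs
  norm_num
  linarith [hc.2, hs.2]

theorem exists_conjFun_root : ∃ τ : ℝ, 2.02875783811043 < τ ∧ τ < 2.02875783811044 ∧
    conjFun τ = 0 ∧ (∀ t, 0 < t → t < τ → 0 < conjFun t) ∧
    (∀ t, τ < t → t ≤ Real.pi → conjFun t < 0) := by
  have hp1 := Real.pi_gt_d20
  have hp2 := Real.pi_lt_d20
  obtain ⟨τ, hτ, h0⟩ := intermediate_value_Ioo' (a := (2.02875783811043 : ℝ))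
    (b := 2.02875783811044) (by norm_num) continuous_conjFun.continuousOn
    (show (0 : ℝ) ∈ _ from ⟨conjFun_upper, conjFun_lower⟩)
  have hτI : τ ∈ Set.Icc (Real.pi / 2) Real.pi := by
    constructor <;> linarith [hτ.1, hτ.2]
  refine ⟨τ, hτ.1, hτ.2, h0, fun t ht htτ => ?_, fun t ht htp => ?_⟩
  · rcases le_total t (Real.pi / 2) with h | h
    · exact conjFun_pos_of_le_pi_div_two ht h
    · rw [← h0]
      exact strictAntiOn_conjFun ⟨h, by linarith [hτI.2]⟩ hτI htτ
  · rw [← h0]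
    exact strictAntiOn_conjFun hτI ⟨by linarith [hτI.1], htp⟩ ht

/-- The bracket has width `10⁻¹⁴`, and the factor `√2 / π < 1 / 2` brings this below `5 · 10⁻¹⁵`. -/
theorem approx_of_mem {τ : ℝ} (h1 : 2.02875783811043 < τ) (h2 : τ < 2.02875783811044) :
    |τ * √2 / Real.pi - 0.91326189159122| ≤ 5 / 10 ^ 15 := by
  have hp1 := Real.pi_gt_d20
  have hp2 := Real.pi_lt_d20
  have hs1 : (1.41421356237309504880 : ℝ) < √2 := Real.lt_sqrt_of_sq_lt (by norm_num)
  have hs2 : √2 < (1.41421356237309504881 : ℝ) := by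
    rw [Real.sqrt_lt' (by norm_num)]; norm_num
  have hp : 0 < Real.pi := Real.pi_pos
  rw [abs_le]
  constructor
  · rw [neg_le_sub_iff_le_add, ← sub_le_iff_le_add, le_div_iff₀ hp]
    have : (2.02875783811043 : ℝ) * 1.41421356237309504880 ≤ τ * √2 := by gcongr
    nlinarith
  · rw [sub_le_iff_le_add, div_le_iff₀ hp]
    have : τ * √2 ≤ (2.02875783811044 : ℝ) * 1.41421356237309504881 := by gcongr
    nlinarith

theorem isLeast_of_conjFun_root {τ : ℝ} (hτ : 0 < τ) (h0 : conjFun τ = 0)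
    (hpos : ∀ t, 0 < t → t < τ → 0 < conjFun t) :
    IsLeast {t : ℝ | 0 < t ∧ Real.sin t / t + Real.cos t = 0} τ := by
  have key : ∀ t : ℝ, 0 < t → (Real.sin t / t + Real.cos t = 0 ↔ conjFun t = 0) := by
    intro t ht
    have : Real.sin t / t + Real.cos t = conjFun t / t := by
      unfold conjFun; field_simp
    rw [this, div_eq_zero_iff, or_iff_left ht.ne']
  refine ⟨⟨hτ, (key τ hτ).2 h0⟩, fun t ht => ?_⟩
  by_contra! hlt
  exact (hpos t ht.1 hlt).ne' ((key t ht.1).1 ht.2)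

/-! ### Calibrations along piecewise `C¹` curves. -/

section Calibration

variable {E : Type*} [NormedAddCommGroup E] [NormedSpace ℝ E]

/-- A function whose derivative along every curve in a set is at most the speed of the curve
grows along a piecewise `C¹` curve in the set by at most the length of the curve. -/
theorem sub_le_integral_speed {M : Set E} {σ : E → E → ℝ}
    (hσ : Continuous fun q : E × E => σ q.1 q.2) {f : E → ℝ}
    (hf : ∀ Z ∈ M, ContinuousAt f Z)
    (hb : ∀ (c : ℝ → E) (ξ : E) (t : ℝ), (∀ᶠ s in nhds t, c s ∈ M) → HasDerivAt c ξ t →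
      ∃ k, HasDerivAt (fun s => f (c s)) k t ∧ k ≤ σ (c t) ξ)
    {c : ℝ → E} (hcont : ContinuousOn c (Set.Icc 0 1)) (hmem : ∀ t ∈ Set.Icc (0 : ℝ) 1, c t ∈ M)
    (S : Finset ℝ) (hS : ∀ a b : ℝ, 0 ≤ a → a < b → b ≤ 1 →
      (∀ s ∈ S, s ∉ Set.Ioo a b) → ContDiffOn ℝ 1 c (Set.Icc a b)) :
    f (c 1) - f (c 0) ≤ ∫ t in (0 : ℝ)..1, σ (c t) (deriv c t) := by
  set v : ℝ → ℝ := fun t => σ (c t) (deriv c t) with hv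
  -- Induction on the number of breakpoints inside `(a, b)`, splitting at one of them. Integrability
  -- is carried along because adding the two integrals needs it.
  have key : ∀ (N : ℕ) (a b : ℝ), 0 ≤ a → a < b → b ≤ 1 →
      (S.filter fun s => s ∈ Set.Ioo a b).card ≤ N →
      IntervalIntegrable v MeasureTheory.volume a b ∧ f (c b) - f (c a) ≤ ∫ t in a..b, v t := by
    intro N
    induction N with
    | zero =>
      intro a b ha hab hb1 hcard
      have hno : ∀ s ∈ S, s ∉ Set.Ioo a b := by
        rw [Nat.le_zero, Finset.card_eq_zero, Finset.filter_eq_empty_iff] at hcard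
        exact fun s hs => hcard hs
      have hsub : Set.Icc a b ⊆ Set.Icc 0 1 := Set.Icc_subset_Icc ha hb1
      have hC := hS a b ha hab hb1 hno
      -- The derivative within the interval is continuous up to the endpoints, where `deriv c` may
      -- be a default value; the two agree in the interior, which suffices for integrability.
      have hderiv : ContinuousOn (derivWithin c (Set.Icc a b)) (Set.Icc a b) :=
        hC.continuousOn_derivWithin (uniqueDiffOn_Icc hab) le_rfl
      have hcontv : ContinuousOn (fun t => σ (c t) (derivWithin c (Set.Icc a b) t)) (Set.Icc a b) :=
        hσ.comp_continuousOn
          ((hcont.mono hsub).prodMk hderiv)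
      have hd : ∀ t ∈ Set.Ioo a b, HasDerivAt c (deriv c t) t := fun t ht =>
        ((hC.differentiableOn one_ne_zero t (Set.Ioo_subset_Icc_self ht)).differentiableAt
          (Icc_mem_nhds ht.1 ht.2)).hasDerivAt
      have heq : Set.EqOn (fun t => σ (c t) (derivWithin c (Set.Icc a b) t)) v (Set.Ioo a b) := fun t ht => by
        have : derivWithin c (Set.Icc a b) t = deriv c t :=
          derivWithin_of_mem_nhds (Icc_mem_nhds ht.1 ht.2)
        simp only [hv, this]
      have hint : MeasureTheory.IntegrableOn v (Set.Icc a b) := by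
        rw [integrableOn_Icc_iff_integrableOn_Ioo]
        exact ((hcontv.integrableOn_Icc).mono_set Set.Ioo_subset_Icc_self).congr_fun heq
          measurableSet_Ioo
      refine ⟨(intervalIntegrable_iff_integrableOn_Icc_of_le hab.le).2 hint, ?_⟩
      have hmemn : ∀ t ∈ Set.Ioo a b, ∀ᶠ s in nhds t, c s ∈ M := fun t ht => by
        filter_upwards [Icc_mem_nhds ht.1 ht.2] with s hs using hmem s (hsub hs)
      choose! k hk1 hk2 using fun t (ht : t ∈ Set.Ioo a b) =>
        hb c (deriv c t) t (hmemn t ht) (hd t ht)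
      refine intervalIntegral.sub_le_integral_of_hasDeriv_right_of_le (g := fun t => f (c t))
        (g' := k) hab.le (fun t ht => ?_) (fun t ht => (hk1 t ht).hasDerivWithinAt) hint hk2
      exact (hf _ (hmem t (hsub ht))).comp_continuousWithinAt (hcont.mono hsub t ht)
    | succ N ih =>
      intro a b ha hab hb1 hcard
      by_cases hex : ∃ s ∈ S, s ∈ Set.Ioo a b
      · obtain ⟨s, hs, hsI⟩ := hex
        have hlt : ∀ P : ℝ → Prop, ∀ [DecidablePred P], (∀ x, P x → x ∈ Set.Ioo a b) → ¬ P s →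
            (S.filter P).card ≤ N := by
          intro P _ hP hPs
          refine Nat.lt_succ_iff.1 (lt_of_lt_of_le (Finset.card_lt_card ?_) hcard)
          refine ⟨fun x hx => ?_, fun h => ?_⟩
          · rw [Finset.mem_filter] at hx ⊢
            exact ⟨hx.1, hP x hx.2⟩
          · exact hPs (Finset.mem_filter.1 (h (Finset.mem_filter.2 ⟨hs, hsI⟩))).2
        obtain ⟨i1, l1⟩ := ih a s ha hsI.1 (hsI.2.le.trans hb1)
          (hlt _ (fun x hx => ⟨hx.1, hx.2.trans hsI.2⟩) fun h => lt_irrefl _ h.2)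
        obtain ⟨i2, l2⟩ := ih s b (ha.trans hsI.1.le) hsI.2 hb1
          (hlt _ (fun x hx => ⟨hsI.1.trans hx.1, hx.2⟩) fun h => lt_irrefl _ h.1)
        refine ⟨i1.trans i2, ?_⟩
        rw [← intervalIntegral.integral_add_adjacent_intervals i1 i2]
        linarith
      · push Not at hex
        refine ih a b ha hab hb1 (le_of_eq_of_le ?_ (Nat.zero_le N))
        rw [Finset.card_eq_zero, Finset.filter_eq_empty_iff]
        exact fun s hs => hex s hs
  exact (key _ 0 1 le_rfl one_pos le_rfl le_rfl).2

end Calibration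

-- Lengths, distances and cut times.

attribute [local instance] Matrix.frobeniusNormedAddCommGroup Matrix.frobeniusNormedSpace

theorem metric_smul_smul {n p : ℕ} (β k : ℝ) (X ξ : Matrix (Fin n) (Fin p) ℝ) :
    metric β X (k • ξ) (k • ξ) = k ^ 2 * metric β X ξ ξ := by
  simp only [metric, Matrix.transpose_smul, Matrix.mul_smul, Matrix.smul_mul, Matrix.trace_smul,
    smul_eq_mul]
  ring

/-- The curves are concatenated, each run at double speed; the corner at `1 / 2` is the only
breakpoint. -/
theorem riemannianDist_le_add {n p : ℕ} {β l₁ l₂ : ℝ} {c₁ c₂ : ℝ → Matrix (Fin n) (Fin p) ℝ}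
    (hc₁ : ContDiff ℝ 1 c₁) (hm₁ : ∀ t, c₁ t ∈ manifold n p) (hl₁ : 0 ≤ l₁)
    (hs₁ : ∀ t, metric β (c₁ t) (deriv c₁ t) (deriv c₁ t) = l₁ ^ 2)
    (hc₂ : ContDiff ℝ 1 c₂) (hm₂ : ∀ t, c₂ t ∈ manifold n p) (hl₂ : 0 ≤ l₂)
    (hs₂ : ∀ t, metric β (c₂ t) (deriv c₂ t) (deriv c₂ t) = l₂ ^ 2)
    (h : c₁ 1 = c₂ 0) :
    riemannianDist β (c₁ 0) (c₂ 1) ≤ ENNReal.ofReal (l₁ + l₂) := by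
  set c : ℝ → Matrix (Fin n) (Fin p) ℝ :=
    fun t => if t ≤ 1 / 2 then c₁ (2 * t) else c₂ (2 * t - 1) with hc
  have e₁ : ∀ t, t ≤ 1 / 2 → c t = c₁ (2 * t) := fun t ht => by simp only [hc]; rw [if_pos ht]
  have e₂ : ∀ t, 1 / 2 ≤ t → c t = c₂ (2 * t - 1) := fun t ht => by
    rcases ht.eq_or_lt with rfl | ht
    · rw [e₁ _ le_rfl]; norm_num [h]
    · simp only [hc]; rw [if_neg (not_le.2 ht)]
  have d₁ : ∀ t, t < 1 / 2 → deriv c t = (2 : ℝ) • deriv c₁ (2 * t) := fun t ht => by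
    have : c =ᶠ[nhds t] fun t => c₁ (2 * t) := by
      filter_upwards [Iio_mem_nhds ht] with s hs using e₁ s (le_of_lt hs)
    exact this.deriv_eq.trans (deriv_comp_mul_left (2 : ℝ) c₁ t)
  have d₂ : ∀ t, 1 / 2 < t → deriv c t = (2 : ℝ) • deriv c₂ (2 * t - 1) := fun t ht => by
    have : c =ᶠ[nhds t] fun t => c₂ (2 * t - 1) := by
      filter_upwards [Ioi_mem_nhds ht] with s hs using e₂ s (le_of_lt hs)
    exact this.deriv_eq.trans ((deriv_comp_mul_left (2 : ℝ) (fun t => c₂ (t - 1)) t).trans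
      (congrArg _ (deriv_comp_sub_const _ _ _)))
  have hpc : IsPiecewiseC1Curve c := by
    refine ⟨Continuous.continuousOn ?_, fun t _ => ?_, {1 / 2}, fun a b _ hab _ hS => ?_⟩
    · refine Continuous.if_le (hc₁.continuous.comp (by fun_prop))
        (hc₂.continuous.comp (by fun_prop)) continuous_id continuous_const ?_
      rintro t rfl
      norm_num [h]
    · rcases le_total t (1 / 2) with ht | ht
      · rw [e₁ t ht]; exact hm₁ _
      · rw [e₂ t ht]; exact hm₂ _
    · have hS := hS (1 / 2) (Finset.mem_singleton_self _)
      rcases le_or_gt b (1 / 2) with hb | hb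
      · exact (hc₁.comp (by fun_prop : ContDiff ℝ 1 fun t : ℝ => 2 * t)).contDiffOn.congr
          fun t ht => e₁ t (ht.2.trans hb)
      · have ha : 1 / 2 ≤ a := by
          by_contra! ha
          exact hS ⟨ha, hb⟩
        exact (hc₂.comp (by fun_prop : ContDiff ℝ 1 fun t : ℝ => 2 * t - 1)).contDiffOn.congr
          fun t ht => e₂ t (ha.trans ht.1)
  have s₁ : ∀ t, t < 1 / 2 → √(metric β (c t) (deriv c t) (deriv c t)) = 2 * l₁ := fun t ht => by
    rw [d₁ t ht, e₁ t ht.le, metric_smul_smul, hs₁, ← mul_pow, Real.sqrt_sq (by positivity)]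
  have s₂ : ∀ t, 1 / 2 < t → √(metric β (c t) (deriv c t) (deriv c t)) = 2 * l₂ := fun t ht => by
    rw [d₂ t ht, e₂ t ht.le, metric_smul_smul, hs₂, ← mul_pow, Real.sqrt_sq (by positivity)]
  -- At the corner the derivative is not controlled, so the speed is known only almost everywhere.
  have hne : ∀ᵐ t : ℝ, t ≠ 1 / 2 := by
    simp [MeasureTheory.ae_iff]
  have i₁ : ∀ᵐ t : ℝ, t ∈ Set.uIoc 0 (1 / 2) →
      2 * l₁ = √(metric β (c t) (deriv c t) (deriv c t)) := by
    filter_upwards [hne] with t ht ht'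
    rw [Set.uIoc_of_le (by norm_num)] at ht'
    exact (s₁ t (lt_of_le_of_ne ht'.2 ht)).symm
  have i₂ : ∀ᵐ t : ℝ, t ∈ Set.uIoc (1 / 2) 1 →
      2 * l₂ = √(metric β (c t) (deriv c t) (deriv c t)) := by
    refine Filter.Eventually.of_forall fun t ht' => ?_
    rw [Set.uIoc_of_le (by norm_num)] at ht'
    exact (s₂ t ht'.1).symm
  have hlen : curveLength β c = l₁ + l₂ := by
    unfold curveLength
    rw [← intervalIntegral.integral_add_adjacent_intervals (b := 1 / 2),
      ← intervalIntegral.integral_congr_ae i₁, ← intervalIntegral.integral_congr_ae i₂]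
    · simp only [intervalIntegral.integral_const, smul_eq_mul]; ring
    · refine (intervalIntegrable_const (c := 2 * l₁)).congr_ae ?_
      exact (MeasureTheory.ae_restrict_iff' measurableSet_uIoc).2 i₁
    · refine (intervalIntegrable_const (c := 2 * l₂)).congr_ae ?_
      exact (MeasureTheory.ae_restrict_iff' measurableSet_uIoc).2 i₂
  rw [← hlen]
  refine iInf₂_le c ⟨hpc, ?_, ?_⟩
  · rw [e₁ 0 (by norm_num), mul_zero]
  · rw [e₂ 1 (by norm_num)]; norm_num

theorem metric_zero_zero {n p : ℕ} (β : ℝ) (X : Matrix (Fin n) (Fin p) ℝ) :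
    metric β X 0 0 = 0 := by
  simp [metric]

theorem riemannianDist_le {n p : ℕ} {β l : ℝ} {c : ℝ → Matrix (Fin n) (Fin p) ℝ}
    (hc : ContDiff ℝ 1 c) (hm : ∀ t, c t ∈ manifold n p) (hl : 0 ≤ l)
    (hs : ∀ t, metric β (c t) (deriv c t) (deriv c t) = l ^ 2) :
    riemannianDist β (c 0) (c 1) ≤ ENNReal.ofReal l := by
  have := riemannianDist_le_add (c₂ := fun _ => c 1) (l₂ := 0) hc hm hl hs contDiff_const
    (fun _ => hm 1) le_rfl (fun t => by
      rw [show deriv (fun _ : ℝ => c 1) t = 0 from deriv_const t (c 1), metric_zero_zero]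
      norm_num) rfl
  simpa using this

/-- The affine reparametrization of a unit-speed curve. -/
theorem speed_comp_affine {n p : ℕ} {β : ℝ} {γ : ℝ → Matrix (Fin n) (Fin p) ℝ}
    (hs : ∀ t, metric β (γ t) (deriv γ t) (deriv γ t) = 1) (a k t : ℝ) :
    metric β (γ (a + k * t)) (deriv (fun s => γ (a + k * s)) t)
      (deriv (fun s => γ (a + k * s)) t) = k ^ 2 := by
  have h : deriv (fun s => γ (a + k * s)) t = k • deriv γ (a + k * t) :=
    (deriv_comp_mul_left k (fun s => γ (a + s)) t).trans (congrArg _ (deriv_comp_const_add _ _ _))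
  rw [h, metric_smul_smul, hs, mul_one]

/-- A shortcut to `γ t₀`, followed by `γ` itself from `t₀` to `t`, has length `l + (t - t₀) < t`.
Hence minimality, once lost, stays lost. -/
theorem cutTime_le {n p : ℕ} {β b : ℝ} {γ : ℝ → Matrix (Fin n) (Fin p) ℝ}
    (hγ : ContDiff ℝ 1 γ) (hm : ∀ t, γ t ∈ manifold n p)
    (hs : ∀ t, metric β (γ t) (deriv γ t) (deriv γ t) = 1)
    (hb : ∀ b' > b, ∃ (t l : ℝ) (c : ℝ → Matrix (Fin n) (Fin p) ℝ), t < b' ∧ ContDiff ℝ 1 c ∧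
      (∀ s, c s ∈ manifold n p) ∧ 0 ≤ l ∧ l < t ∧
      (∀ s, metric β (c s) (deriv c s) (deriv c s) = l ^ 2) ∧ c 0 = γ 0 ∧ c 1 = γ t) :
    cutTime β γ ≤ ENNReal.ofReal b := by
  refine iSup₂_le fun t ht => ENNReal.ofReal_le_ofReal ?_
  by_contra! hlt
  obtain ⟨t₀, l, c, h1, hc, hcm, hl0, hlt, hcs, hc0, hc1⟩ := hb t hlt
  have h := riemannianDist_le_add (c₂ := fun s => γ (t₀ + (t - t₀) * s)) hc hcm hl0 hcs
    (hγ.comp (by fun_prop)) (fun s => hm _) (sub_nonneg.2 h1.le)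
    (speed_comp_affine hs t₀ (t - t₀)) (by simp [hc1])
  simp only [mul_one, add_sub_cancel] at h
  rw [hc0, ht.2, ENNReal.ofReal_le_ofReal_iff (by linarith)] at h
  linarith

theorem injRadius_le {n p : ℕ} {β : ℝ} {b : ℝ≥0∞} {γ : ℝ → Matrix (Fin n) (Fin p) ℝ}
    (hγ : IsGeodesic β γ) (hT : deriv γ 0 ∈ tangentSpace (γ 0))
    (hs : metric β (γ 0) (deriv γ 0) (deriv γ 0) = 1) (hb : cutTime β γ ≤ b) :
    injRadius β n p ≤ b := by
  refine le_trans ?_ hb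
  refine (iInf₂_le (γ 0) (hγ.2.1 0)).trans ?_
  refine (iInf₂_le (deriv γ 0) ⟨hT, hs⟩).trans ?_
  exact iInf₂_le γ ⟨hγ, rfl, rfl⟩

theorem le_injRadius {n p : ℕ} {β : ℝ} {b : ℝ≥0∞}
    (h : ∀ γ : ℝ → Matrix (Fin n) (Fin p) ℝ, IsGeodesic β γ →
      deriv γ 0 ∈ tangentSpace (γ 0) → metric β (γ 0) (deriv γ 0) (deriv γ 0) = 1 →
      b ≤ cutTime β γ) :
    b ≤ injRadius β n p := by
  refine le_iInf₂ fun X _ => le_iInf₂ fun ξ hξ => le_iInf₂ fun γ hγ => ?_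
  obtain ⟨h1, rfl, rfl⟩ := hγ
  exact h γ h1 hξ.1 hξ.2

theorem continuous_metric {n p : ℕ} (β : ℝ) :
    Continuous fun q : Matrix (Fin n) (Fin p) ℝ × Matrix (Fin n) (Fin p) ℝ =>
      metric β q.1 q.2 q.2 := by
  unfold metric
  fun_prop

theorem sub_le_curveLength {n p : ℕ} {β : ℝ} {f : Matrix (Fin n) (Fin p) ℝ → ℝ}
    (hf : ∀ Z ∈ manifold n p, ContinuousAt f Z)
    (hb : ∀ (c : ℝ → Matrix (Fin n) (Fin p) ℝ) (ξ : Matrix (Fin n) (Fin p) ℝ) (t : ℝ),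
      (∀ᶠ s in nhds t, c s ∈ manifold n p) → HasDerivAt c ξ t →
      ∃ k, HasDerivAt (fun s => f (c s)) k t ∧ k ≤ √(metric β (c t) ξ ξ))
    {c : ℝ → Matrix (Fin n) (Fin p) ℝ} (hc : IsPiecewiseC1Curve c) :
    f (c 1) - f (c 0) ≤ curveLength β c := by
  obtain ⟨hcont, hmem, S, hS⟩ := hc
  exact sub_le_integral_speed (M := manifold n p)
    (σ := fun X ξ => √(metric β X ξ ξ)) (Real.continuous_sqrt.comp (continuous_metric β)) hf hb
    hcont hmem S hS

/-! ### Entrywise calculus of matrix-valued curves. -/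

section MatrixCalculus

variable {ι κ μ : Type*} [Fintype κ]

theorem hasDerivAt_matrix [Fintype ι] {A : ℝ → Matrix ι κ ℝ} {A' : Matrix ι κ ℝ} {t : ℝ} :
    HasDerivAt A A' t ↔ ∀ i j, HasDerivAt (fun s => A s i j) (A' i j) t := by
  have h1 : HasDerivAt A A' t ↔ ∀ i, HasDerivAt (fun s => A s i) (A' i) t :=
    hasDerivAt_pi (φ := fun s => (A s : ι → κ → ℝ)) (φ' := A')
  rw [h1]
  exact forall_congr' fun i => hasDerivAt_pi

theorem contDiff_matrix [Fintype ι] {k : WithTop ℕ∞} {E : Type*} [NormedAddCommGroup E] [NormedSpace ℝ E]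
    {A : E → Matrix ι κ ℝ} : ContDiff ℝ k A ↔ ∀ i j, ContDiff ℝ k fun s => A s i j := by
  let e : Matrix ι κ ℝ ≃L[ℝ] (ι → κ → ℝ) :=
    LinearEquiv.toContinuousLinearEquiv (LinearEquiv.refl ℝ (ι → κ → ℝ) : Matrix ι κ ℝ ≃ₗ[ℝ] _)
  have h1 : ContDiff ℝ k A ↔ ContDiff ℝ k fun s => e (A s) :=
    (e.comp_contDiff_iff (f := A)).symm
  rw [h1, contDiff_pi]
  exact forall_congr' fun i => contDiff_pi

theorem hasDerivAt_matrix_mul [Fintype ι] [Fintype μ] {A : ℝ → Matrix ι κ ℝ} {B : ℝ → Matrix κ μ ℝ} {A' : Matrix ι κ ℝ}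
    {B' : Matrix κ μ ℝ} {t : ℝ} (hA : HasDerivAt A A' t) (hB : HasDerivAt B B' t) :
    HasDerivAt (fun s => A s * B s) (A' * B t + A t * B') t := by
  rw [hasDerivAt_matrix] at hA hB ⊢
  intro i j
  simp only [Matrix.mul_apply, Matrix.add_apply, ← Finset.sum_add_distrib]
  exact HasDerivAt.fun_sum fun k _ => (hA i k).mul (hB k j)

theorem hasDerivAt_matrix_transpose [Fintype ι] {A : ℝ → Matrix ι κ ℝ} {A' : Matrix ι κ ℝ} {t : ℝ}
    (hA : HasDerivAt A A' t) : HasDerivAt (fun s => (A s)ᵀ) A'ᵀ t := by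
  rw [hasDerivAt_matrix] at hA ⊢
  exact fun i j => hA j i

theorem hasDerivAt_matrix_trace {A : ℝ → Matrix κ κ ℝ} {A' : Matrix κ κ ℝ} {t : ℝ}
    (hA : HasDerivAt A A' t) : HasDerivAt (fun s => (A s).trace) A'.trace t := by
  rw [hasDerivAt_matrix] at hA
  exact HasDerivAt.fun_sum fun i _ => hA i i

theorem contDiff_entry [Fintype ι] {k : WithTop ℕ∞} (i : ι) (j : κ) :
    ContDiff ℝ k fun A : Matrix ι κ ℝ => A i j :=
  contDiff_matrix.1 contDiff_id i j

end MatrixCalculus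

/-! ### The geodesic equation in closed form. -/

theorem metric_eq {n p : ℕ} (β : ℝ) (X ξ η : Matrix (Fin n) (Fin p) ℝ) :
    metric β X ξ η = (ξᵀ * η).trace - (1 - β) * (ξᵀ * (X * Xᵀ) * η).trace := by
  simp only [metric, Matrix.transpose_mul, Matrix.transpose_transpose, Matrix.mul_sub,
    Matrix.sub_mul, Matrix.trace_sub, Matrix.mul_one, Matrix.mul_assoc]
  ring

theorem metricDeriv_eq {n p : ℕ} (β : ℝ) (X ζ ξ η : Matrix (Fin n) (Fin p) ℝ) :
    metricDeriv β X ζ ξ η = -(1 - β) * (ξᵀ * (ζ * Xᵀ + X * ζᵀ) * η).trace := by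
  have hdiff : DifferentiableAt ℝ (fun Z => metric β Z ξ η) X := by
    have : ContDiff ℝ 1 (fun Z => metric β Z ξ η) := by
      simp only [metric_eq, Matrix.trace, Matrix.mul_apply, Matrix.diag_apply,
        Matrix.transpose_apply]
      exact contDiff_const.sub (contDiff_const.mul (ContDiff.sum fun i _ => ContDiff.sum fun j _ =>
        (ContDiff.sum fun k _ => contDiff_const.mul (ContDiff.sum fun l _ =>
          (contDiff_entry k l).mul (contDiff_entry j l))).mul contDiff_const))
    exact this.differentiable one_ne_zero X
  have hline : HasDerivAt (fun s : ℝ => X + s • ζ) ζ 0 := by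
    rw [hasDerivAt_matrix]
    intro i j
    simpa using ((hasDerivAt_id (0 : ℝ)).mul_const (ζ i j)).const_add (X i j)
  have h0 : X + (0 : ℝ) • ζ = X := by simp
  have h1 : HasDerivAt (fun s : ℝ => metric β (X + s • ζ) ξ η) (metricDeriv β X ζ ξ η) 0 := by
    refine HasFDerivAt.comp_hasDerivAt (0 : ℝ) (l := fun Z => metric β Z ξ η) ?_ hline
    rw [h0]
    exact hdiff.hasFDerivAt
  refine h1.unique ?_
  simp only [metric_eq]
  have h2 := hasDerivAt_matrix_trace (hasDerivAt_matrix_mul (hasDerivAt_matrix_mul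
    (hasDerivAt_const (0 : ℝ) ξᵀ) (hasDerivAt_matrix_mul hline (hasDerivAt_matrix_transpose hline)))
    (hasDerivAt_const (0 : ℝ) η))
  have h3 := (h2.const_mul (1 - β)).const_sub ((ξᵀ * η).trace)
  convert h3 using 1
  simp
  ring

theorem covariantAcceleration_eq {n p : ℕ} (β : ℝ) (γ : ℝ → Matrix (Fin n) (Fin p) ℝ) (t : ℝ)
    (η : Matrix (Fin n) (Fin p) ℝ) :
    covariantAcceleration β γ t η =
      ((deriv (deriv γ) t)ᵀ * η).trace - (1 - β) * (
        ((deriv (deriv γ) t)ᵀ * γ t * ((γ t)ᵀ * η)).trace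
        + ((deriv γ t)ᵀ * deriv γ t * ((γ t)ᵀ * η)).trace
        + ((deriv γ t)ᵀ * γ t * ((deriv γ t)ᵀ * η)).trace
        - ((deriv γ t)ᵀ * η * ((γ t)ᵀ * deriv γ t)).trace) := by
  simp only [covariantAcceleration, metric_eq, metricDeriv_eq]
  -- The two terms of the derivative in direction `η` are transposes of each other, which absorbs
  -- the factor `1 / 2`.
  have h : ((deriv γ t)ᵀ * (γ t * ηᵀ) * deriv γ t).trace =
      ((deriv γ t)ᵀ * (η * (γ t)ᵀ) * deriv γ t).trace := by
    rw [← Matrix.trace_transpose]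
    simp [Matrix.mul_assoc]
  simp only [Matrix.mul_add, Matrix.add_mul, Matrix.trace_add, h]
  simp only [Matrix.mul_assoc]
  ring

theorem metric_self {n p : ℕ} (β : ℝ) (X ξ : Matrix (Fin n) (Fin p) ℝ) :
    metric β X ξ ξ = (ξᵀ * ξ).trace - (1 - β) * ((Xᵀ * ξ)ᵀ * (Xᵀ * ξ)).trace := by
  rw [metric_eq]
  simp only [Matrix.transpose_mul, Matrix.transpose_transpose, Matrix.mul_assoc]

theorem trace_mul_eq_zero_of_symm_of_skew {p : ℕ} {E G : Matrix (Fin p) (Fin p) ℝ} (hE : Eᵀ = E)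
    (hG : Gᵀ = -G) : (E * G).trace = 0 := by
  have h : (E * G).trace = -(E * G).trace := by
    conv_lhs => rw [← Matrix.trace_transpose, Matrix.transpose_mul, hE, hG, Matrix.trace_mul_comm]
    simp
  linarith

theorem transpose_mul_skew {n p : ℕ} {X η : Matrix (Fin n) (Fin p) ℝ} (h : η ∈ tangentSpace X) :
    (Xᵀ * η)ᵀ = -(Xᵀ * η) := by
  have h : Xᵀ * η + ηᵀ * X = 0 := h
  rw [Matrix.transpose_mul, Matrix.transpose_transpose]
  exact eq_neg_of_add_eq_zero_right h

/-- Every term of the covariant acceleration either contains `γᵀ γ' = 0` or is a multiple of `tr (E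
γᵀ η)`, a symmetric matrix paired with a skew one. So `β` plays no role. -/
theorem isGeodesic_of_horizontal {n p : ℕ} {β : ℝ} {γ : ℝ → Matrix (Fin n) (Fin p) ℝ}
    (hγ : ContDiff ℝ ∞ γ) (hm : ∀ t, γ t ∈ manifold n p) {E : Matrix (Fin p) (Fin p) ℝ}
    (hE : Eᵀ = E) (h1 : ∀ t, (γ t)ᵀ * deriv γ t = 0) (h2 : ∀ t, (deriv γ t)ᵀ * deriv γ t = E)
    (h3 : ∀ t, deriv (deriv γ) t = -(γ t * E)) : IsGeodesic β γ := by
  refine ⟨hγ, hm, fun t η hη => ?_⟩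
  have hX : (γ t)ᵀ * γ t = 1 := hm t
  have h1' : (deriv γ t)ᵀ * γ t = 0 := by
    have := congrArg Matrix.transpose (h1 t)
    simpa using this
  have hz := trace_mul_eq_zero_of_symm_of_skew hE (transpose_mul_skew hη)
  have e1 : (deriv (deriv γ) t)ᵀ = -(E * (γ t)ᵀ) := by
    rw [h3, Matrix.transpose_neg, Matrix.transpose_mul, hE]
  rw [covariantAcceleration_eq, e1, h2, h1', h1]
  rw [Matrix.neg_mul, Matrix.neg_mul, Matrix.mul_assoc E, Matrix.mul_assoc E, hX]
  simp [hz]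

/-! ### Blocks and the geodesic arcs that rotate them. -/

/-- Matrices `P`, `N`, `R` such that `P + R` is an orthonormal frame and `N` is an orthonormal frame
in the orthogonal complement of its span, of the same rank as `P`. -/
structure Block {n p : ℕ} (D : Matrix (Fin p) (Fin p) ℝ) (P N R : Matrix (Fin n) (Fin p) ℝ) :
    Prop where
  PP : Pᵀ * P = D
  NN : Nᵀ * N = D
  PN : Pᵀ * N = 0
  PR : Pᵀ * R = 0
  NR : Nᵀ * R = 0
  RR : Rᵀ * R = 1 - D
  PD : P * D = P
  ND : N * D = N
  RD : R * D = 0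

namespace Block

variable {n p : ℕ} {D : Matrix (Fin p) (Fin p) ℝ} {P N R : Matrix (Fin n) (Fin p) ℝ}

theorem D_symm (h : Block D P N R) : Dᵀ = D := by
  rw [← h.PP, Matrix.transpose_mul, Matrix.transpose_transpose]

theorem NP (h : Block D P N R) : Nᵀ * P = 0 := by
  simpa using congrArg Matrix.transpose h.PN

theorem RP (h : Block D P N R) : Rᵀ * P = 0 := by
  simpa using congrArg Matrix.transpose h.PR

theorem RN (h : Block D P N R) : Rᵀ * N = 0 := by
  simpa using congrArg Matrix.transpose h.NR

theorem transpose_mul (h : Block D P N R) (Z V Z' V' : Matrix (Fin p) (Fin p) ℝ) :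
    (P * Z + N * V + R)ᵀ * (P * Z' + N * V') = Zᵀ * (D * Z') + Vᵀ * (D * V') := by
  have e : ∀ (A B : Matrix (Fin n) (Fin p) ℝ) (C : Matrix (Fin p) (Fin p) ℝ),
      Aᵀ * (B * C) = (Aᵀ * B) * C := fun A B C => (Matrix.mul_assoc _ _ _).symm
  simp only [Matrix.transpose_add, Matrix.transpose_mul, Matrix.add_mul, Matrix.mul_add,
    Matrix.mul_assoc, e, h.PP, h.NN, h.PN, h.NP, h.RP, h.RN, Matrix.zero_mul, Matrix.mul_zero,
    add_zero, zero_add]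

theorem frame_mem (h : Block D P N R) {Z V : Matrix (Fin p) (Fin p) ℝ}
    (hZV : Zᵀ * (D * Z) + Vᵀ * (D * V) = D) : P * Z + N * V + R ∈ manifold n p := by
  change (P * Z + N * V + R)ᵀ * (P * Z + N * V + R) = 1
  rw [Matrix.mul_add, h.transpose_mul, hZV]
  simp only [Matrix.transpose_add, Matrix.transpose_mul, Matrix.add_mul, Matrix.mul_assoc, h.PR,
    h.NR, h.RR, Matrix.mul_zero]
  abel

theorem speed (h : Block D P N R) (β : ℝ) (Z V Z' V' : Matrix (Fin p) (Fin p) ℝ) :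
    metric β (P * Z + N * V + R) (P * Z' + N * V') (P * Z' + N * V') =
      (Z'ᵀ * (D * Z') + V'ᵀ * (D * V')).trace - (1 - β) *
      ((Zᵀ * (D * Z') + Vᵀ * (D * V'))ᵀ * (Zᵀ * (D * Z') + Vᵀ * (D * V'))).trace := by
  rw [metric_self, h.transpose_mul]
  have e : (P * Z' + N * V')ᵀ * (P * Z' + N * V') = Z'ᵀ * (D * Z') + V'ᵀ * (D * V') := by
    rw [← h.transpose_mul, Matrix.transpose_add _ R, Matrix.add_mul, Matrix.mul_add Rᵀ,
      ← Matrix.mul_assoc Rᵀ, ← Matrix.mul_assoc Rᵀ, h.RP, h.RN]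
    simp
  rw [e]

/-- The arc that rotates the frame `P` into the frame `N`. -/
noncomputable def arc (P N R : Matrix (Fin n) (Fin p) ℝ) (k t : ℝ) : Matrix (Fin n) (Fin p) ℝ :=
  P * (Real.cos (k * t) • (1 : Matrix (Fin p) (Fin p) ℝ)) + N * (Real.sin (k * t) • (1 : Matrix (Fin p) (Fin p) ℝ)) + R

theorem hasDerivAt_comb {z v : ℝ → ℝ} {z' v' t : ℝ} (P N R : Matrix (Fin n) (Fin p) ℝ)
    (hz : HasDerivAt z z' t) (hv : HasDerivAt v v' t) :
    HasDerivAt (fun t => P * (z t • (1 : Matrix (Fin p) (Fin p) ℝ)) + N * (v t • (1 : Matrix (Fin p) (Fin p) ℝ)) + R)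
      (P * (z' • (1 : Matrix (Fin p) (Fin p) ℝ)) + N * (v' • (1 : Matrix (Fin p) (Fin p) ℝ))) t := by
  rw [hasDerivAt_matrix]
  intro i j
  simpa [Matrix.mul_smul] using ((hz.mul_const (P i j)).add (hv.mul_const (N i j))).add_const (R i j)

theorem hasDerivAt_arc (k t : ℝ) :
    HasDerivAt (arc P N R k)
      (P * ((-(k * Real.sin (k * t))) • (1 : Matrix (Fin p) (Fin p) ℝ)) + N * ((k * Real.cos (k * t)) • (1 : Matrix (Fin p) (Fin p) ℝ))) t := by
  have hk : HasDerivAt (fun t => k * t) k t := by simpa using (hasDerivAt_id t).const_mul k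
  exact hasDerivAt_comb P N R (by simpa [mul_comm] using hk.cos) (by simpa [mul_comm] using hk.sin)

theorem contDiff_arc (k : ℝ) {m : WithTop ℕ∞} : ContDiff ℝ m (arc P N R k) := by
  rw [contDiff_matrix]
  intro i j
  simp only [arc, Matrix.mul_smul, Matrix.mul_one, Matrix.add_apply, Matrix.smul_apply, smul_eq_mul]
  fun_prop

theorem arc_mem (h : Block D P N R) (k t : ℝ) : arc P N R k t ∈ manifold n p := by
  refine h.frame_mem ?_
  simp only [Matrix.transpose_smul, Matrix.transpose_one, Matrix.mul_smul, Matrix.smul_mul,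
    Matrix.mul_one, Matrix.one_mul, smul_smul, ← add_smul]
  rw [← sq, ← sq, Real.cos_sq_add_sin_sq, one_smul]

theorem arc_transpose_mul_deriv (h : Block D P N R) (k t : ℝ) :
    (arc P N R k t)ᵀ * deriv (arc P N R k) t = 0 := by
  have hd : deriv (arc P N R k) t = _ := (hasDerivAt_arc k t).deriv
  rw [hd, arc, h.transpose_mul]
  simp only [Matrix.transpose_smul, Matrix.transpose_one, Matrix.mul_smul, Matrix.smul_mul,
    Matrix.mul_one, Matrix.one_mul, smul_smul, ← add_smul]
  rw [show -(k * Real.sin (k * t)) * Real.cos (k * t) + k * Real.cos (k * t) * Real.sin (k * t) = 0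
    by ring, zero_smul]

theorem arc_deriv_transpose_mul_deriv (h : Block D P N R) (k t : ℝ) :
    (deriv (arc P N R k) t)ᵀ * deriv (arc P N R k) t = k ^ 2 • D := by
  have hd : deriv (arc P N R k) t = _ := (hasDerivAt_arc k t).deriv
  have e := h.transpose_mul ((-(k * Real.sin (k * t))) • (1 : Matrix (Fin p) (Fin p) ℝ)) ((k * Real.cos (k * t)) • (1 : Matrix (Fin p) (Fin p) ℝ))
    ((-(k * Real.sin (k * t))) • (1 : Matrix (Fin p) (Fin p) ℝ)) ((k * Real.cos (k * t)) • (1 : Matrix (Fin p) (Fin p) ℝ))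
  rw [Matrix.transpose_add _ R, Matrix.add_mul, Matrix.mul_add Rᵀ,
      ← Matrix.mul_assoc Rᵀ, ← Matrix.mul_assoc Rᵀ, h.RP, h.RN, Matrix.zero_mul, Matrix.zero_mul,
      add_zero, add_zero] at e
  rw [hd, e]
  simp only [Matrix.transpose_smul, Matrix.transpose_one, Matrix.mul_smul, Matrix.smul_mul,
    Matrix.mul_one, Matrix.one_mul, smul_smul, ← add_smul]
  congr 1
  linear_combination k ^ 2 * Real.sin_sq_add_cos_sq (k * t)

theorem arc_speed (h : Block D P N R) (β k t : ℝ) :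
    metric β (arc P N R k t) (deriv (arc P N R k) t) (deriv (arc P N R k) t) = k ^ 2 * D.trace := by
  rw [metric_self, h.arc_transpose_mul_deriv, h.arc_deriv_transpose_mul_deriv]
  simp

theorem isGeodesic_arc (h : Block D P N R) (β k : ℝ) : IsGeodesic β (arc P N R k) := by
  refine isGeodesic_of_horizontal (E := k ^ 2 • D) (contDiff_arc k) (h.arc_mem k)
    (by rw [Matrix.transpose_smul, h.D_symm]) (h.arc_transpose_mul_deriv k)
    (h.arc_deriv_transpose_mul_deriv k) fun t => ?_
  have hd : deriv (arc P N R k) = fun t =>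
      P * ((-(k * Real.sin (k * t))) • (1 : Matrix (Fin p) (Fin p) ℝ)) + N * ((k * Real.cos (k * t)) • (1 : Matrix (Fin p) (Fin p) ℝ)) + 0 :=
    funext fun t => by rw [add_zero]; exact (hasDerivAt_arc k t).deriv
  have hk : HasDerivAt (fun t => k * t) k t := by simpa using (hasDerivAt_id t).const_mul k
  have hdd := hasDerivAt_comb P N 0 (hk.sin.const_mul k).neg (hk.cos.const_mul k)
  rw [hd]
  refine hdd.deriv.trans ?_
  simp only [arc, Matrix.add_mul, Matrix.mul_smul, Matrix.smul_mul, Matrix.mul_one, h.PD, h.ND,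
    h.RD, smul_add, smul_smul, add_zero, neg_add, ← neg_smul]
  congr 2 <;> ring

theorem arc_zero : arc P N R k 0 = P + R := by simp [arc]

theorem deriv_arc_mem_tangentSpace (h : Block D P N R) (k t : ℝ) :
    deriv (arc P N R k) t ∈ tangentSpace (arc P N R k t) := by
  have h1 := h.arc_transpose_mul_deriv k t
  have h2 : (deriv (arc P N R k) t)ᵀ * arc P N R k t = 0 := by
    simpa using congrArg Matrix.transpose h1
  change _ + _ = 0
  rw [h1, h2, add_zero]

/-- A rank-one block gives a closed geodesic of length `2π`. -/
theorem injRadius_le_pi (h : Block D P N R) (hD : D.trace = 1) (β : ℝ) :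
    injRadius β n p ≤ ENNReal.ofReal Real.pi := by
  have hs : ∀ t, metric β (arc P N R 1 t) (deriv (arc P N R 1) t) (deriv (arc P N R 1) t) = 1 :=
    fun t => by rw [h.arc_speed, hD]; norm_num
  refine injRadius_le (h.isGeodesic_arc β 1) (h.deriv_arc_mem_tangentSpace 1 0) (hs 0)
    (cutTime_le (contDiff_arc 1) (h.arc_mem 1) hs fun b hb => ?_)
  have hp := Real.pi_pos
  -- For `π < t < 2π` the complementary arc of the circle, run backwards with signed angle `t - 2π`,
  -- is shorter.
  obtain ⟨t, ht1, ht2⟩ := exists_between (lt_min hb (by linarith : Real.pi < 2 * Real.pi))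
  rw [lt_min_iff] at ht2
  refine ⟨t, 2 * Real.pi - t, arc P N R (t - 2 * Real.pi), ht2.1, contDiff_arc _, h.arc_mem _,
    by linarith, by linarith, fun s => ?_, ?_, ?_⟩
  · rw [h.arc_speed, hD]; ring
  · rw [arc_zero, arc_zero]
  · simp [arc, Real.cos_sub_two_pi, Real.sin_sub_two_pi]

end Block

/-! ### Blocks made of standard basis vectors. -/

/-- The matrix whose `j`-th column is the basis vector `e_{F j}` if `s j` holds, and zero
otherwise. -/
def columns (n : ℕ) {p : ℕ} (F : Fin p → ℕ) (s : Fin p → Prop) [DecidablePred s] :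
    Matrix (Fin n) (Fin p) ℝ :=
  fun i j => if i.val = F j ∧ s j then 1 else 0

theorem columns_transpose_mul {n p : ℕ} {F G : Fin p → ℕ} {s r : Fin p → Prop} [DecidablePred s]
    [DecidablePred r] (hF : ∀ j, s j → F j < n) (a b : Fin p) :
    ((columns n F s)ᵀ * columns n G r) a b = if F a = G b ∧ s a ∧ r b then 1 else 0 := by
  simp only [Matrix.mul_apply, Matrix.transpose_apply, columns]
  by_cases h : s a
  · rw [Finset.sum_eq_single (⟨F a, hF a h⟩ : Fin n)]
    · simp [h]
    · intro i _ hi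
      have : i.val ≠ F a := fun e => hi (Fin.ext e)
      simp [this]
    · simp
  · simp [h]

theorem columns_mul_diagonal {n p : ℕ} {F : Fin p → ℕ} {s r : Fin p → Prop} [DecidablePred s]
    [DecidablePred r] (i : Fin n) (j : Fin p) :
    (columns n F s * Matrix.diagonal fun j => if r j then (1 : ℝ) else 0) i j =
      if i.val = F j ∧ s j ∧ r j then 1 else 0 := by
  rw [Matrix.mul_diagonal, columns]
  by_cases h : r j <;> simp [h]

/-- The blocks given by the first `k` columns of the standard frame. -/
theorem exists_block {n p k : ℕ} (hn : p + k ≤ n) :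
    ∃ P N R : Matrix (Fin n) (Fin p) ℝ,
      Block (Matrix.diagonal fun j : Fin p => if j.val < k then 1 else 0) P N R := by
  have hp : ∀ j : Fin p, j.val < k → j.val < n := fun j _ => by omega
  have hr : ∀ j : Fin p, ¬ j.val < k → j.val < n := fun j _ => by omega
  -- The columns of `N` are the basis vectors with index `p + j`, `j < k`; the room for them is what
  -- `p + k ≤ n` provides.
  have hk : ∀ j : Fin p, j.val < k → p + j.val < n := fun j _ => by omega
  refine ⟨columns n (fun j => j.val) (fun j => j.val < k),
    columns n (fun j => p + j.val) (fun j => j.val < k),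
    columns n (fun j => j.val) (fun j => ¬ j.val < k), ?_⟩
  constructor <;> ext a b
  · rw [columns_transpose_mul hp, Matrix.diagonal_apply]
    grind
  · rw [columns_transpose_mul hk, Matrix.diagonal_apply]
    grind
  · rw [columns_transpose_mul hp, Matrix.zero_apply]
    grind
  · rw [columns_transpose_mul hp, Matrix.zero_apply]
    grind
  · rw [columns_transpose_mul hk, Matrix.zero_apply]
    grind
  · rw [columns_transpose_mul hr, Matrix.sub_apply, Matrix.one_apply, Matrix.diagonal_apply]
    grind
  · rw [columns_mul_diagonal, columns]
    grind
  · rw [columns_mul_diagonal, columns]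
    grind
  · rw [columns_mul_diagonal, Matrix.zero_apply]
    grind

theorem trace_diagonal_lt {p k : ℕ} (hkp : k ≤ p) :
    (Matrix.diagonal fun j : Fin p => if j.val < k then (1 : ℝ) else 0).trace = k := by
  rw [Matrix.trace_diagonal, Finset.sum_boole, Fin.card_filter_val_lt, min_eq_right hkp]

theorem injRadius_le_pi {n p : ℕ} (hp : 1 ≤ p) (hn : p + 1 ≤ n) (β : ℝ) :
    injRadius β n p ≤ ENNReal.ofReal Real.pi := by
  obtain ⟨P, N, R, h⟩ := exists_block hn
  exact h.injRadius_le_pi (by rw [trace_diagonal_lt hp, Nat.cast_one]) β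

/-! ### The squashed three-sphere and the canonical upper bound. -/

open Filter Topology in
/-- Beyond the first zero of `conjFun`, the horizontal geodesic of the (squashed) three-sphere is
longer than a nearby orbit of a one-parameter group with the same endpoints. -/
theorem exists_shorter_orbit {τ : ℝ} (h0 : 0 < τ) (hπ : τ < Real.pi) (hneg : conjFun τ < 0) :
    ∃ κ ν a b : ℝ, a ^ 2 + b ^ 2 = 1 ∧
      Real.cos κ * Real.cos ν - a * (Real.sin κ * Real.sin ν) = Real.cos τ ∧
      Real.sin κ * Real.cos ν + a * (Real.cos κ * Real.sin ν) = 0 ∧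
      b * Real.sin ν = Real.sin τ ∧
      ν ^ 2 + κ ^ 2 / 2 + κ * (a * ν) - (a * ν) ^ 2 / 2 < τ ^ 2 := by
  have hs : 0 < Real.sin τ := Real.sin_pos_of_pos_of_lt_pi h0 hπ
  set C := Real.cos τ with hC
  have hSC : Real.sin τ ^ 2 + C ^ 2 = 1 := Real.sin_sq_add_cos_sq τ
  set g := τ * C / Real.sin τ with hg
  -- The sign of `conjFun` enters only here, as `τ cot τ < -1`.
  have hg1 : g < -1 := by
    rw [hg, div_lt_iff₀ hs]
    unfold conjFun at hneg
    linarith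
  -- The endpoint conditions say `cos ν + i a sin ν = e^{-iκ} cos τ`. For each twist `κ` they force
  -- `cos ν = cos τ cos κ`, `a sin ν = -cos τ sin κ`, and then `b sin ν = sin τ`.
  set W : ℝ → ℝ := fun κ => Real.arccos (C * Real.cos κ) with hW
  have hsinW : ∀ κ, Real.sin (W κ) = √(1 - (C * Real.cos κ) ^ 2) := fun κ => Real.sin_arccos _
  have hpos : ∀ κ, 0 < 1 - (C * Real.cos κ) ^ 2 := fun κ => by
    nlinarith [Real.sin_sq_add_cos_sq κ, sq_nonneg (C * Real.sin κ), sq_pos_of_pos hs]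
  have hsinpos : ∀ κ, 0 < Real.sin (W κ) := fun κ => by rw [hsinW]; exact Real.sqrt_pos.2 (hpos κ)
  have hcosW : ∀ κ, Real.cos (W κ) = C * Real.cos κ := fun κ =>
    Real.cos_arccos (by nlinarith [hpos κ]) (by nlinarith [hpos κ])
  have hW0 : W 0 = τ := by
    simp only [hW, Real.cos_zero, mul_one, hC]
    exact Real.arccos_cos h0.le hπ.le
  have hWc : Continuous W := Real.continuous_arccos.comp (by fun_prop)
  have hWt : Tendsto W (𝓝[>] 0) (𝓝 τ) := by
    rw [← hW0]; exact (hWc.tendsto 0).mono_left nhdsWithin_le_nhds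
  have hsin1 : Tendsto (fun κ : ℝ => Real.sin κ / κ) (𝓝[>] 0) (𝓝 1) := by
    have h := (hasDerivAt_iff_tendsto_slope_zero.1 (Real.hasDerivAt_sin 0)).mono_left
      (nhdsGT_le_nhdsNE (0 : ℝ))
    simpa [div_eq_inv_mul] using h
  have hcos1 : Tendsto (fun κ : ℝ => (1 - Real.cos κ) / κ ^ 2) (𝓝[>] 0) (𝓝 (1 / 2)) := by
    have hhalf : Tendsto (fun κ : ℝ => κ / 2) (𝓝[>] 0) (𝓝[>] 0) := by
      refine tendsto_nhdsWithin_iff.2 ⟨?_, ?_⟩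
      · have : Continuous fun κ : ℝ => κ / 2 := by fun_prop
        simpa using (this.tendsto 0).mono_left nhdsWithin_le_nhds
      · filter_upwards [self_mem_nhdsWithin] with κ hκ
        exact half_pos (Set.mem_Ioi.1 hκ)
    have h := ((hsin1.comp hhalf).pow 2).const_mul (1 / 2)
    rw [one_pow, mul_one] at h
    refine h.congr' ?_
    filter_upwards [self_mem_nhdsWithin] with κ hκ
    have hκ : κ ≠ 0 := (Set.mem_Ioi.1 hκ).ne'
    have hd : Real.cos κ = 1 - 2 * Real.sin (κ / 2) ^ 2 := by
      have := Real.cos_two_mul (κ / 2)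
      rw [mul_div_cancel₀ κ two_ne_zero] at this
      rw [this, Real.cos_sq']; ring
    simp only [Function.comp]
    rw [hd]
    field_simp
    ring
  have hT1 : Tendsto (fun κ : ℝ => (W κ ^ 2 - τ ^ 2) / κ ^ 2) (𝓝[>] 0) (𝓝 g) := by
    -- Substituting `x = 1 - cos κ ~ κ² / 2` turns the second-order expansion in `κ` into a first
    -- derivative in `x`.
    have hd : HasDerivAt (fun x : ℝ => Real.arccos (C * (1 - x)) ^ 2) (2 * g) 0 := by
      have hC1 : C * (1 - 0) ≠ -1 := by rw [sub_zero, mul_one]; nlinarith [sq_pos_of_pos hs]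
      have hC2 : C * (1 - 0) ≠ 1 := by rw [sub_zero, mul_one]; nlinarith [sq_pos_of_pos hs]
      have hin : HasDerivAt (fun x : ℝ => C * (1 - x)) (C * (-1)) 0 :=
        ((hasDerivAt_id (0 : ℝ)).const_sub 1).const_mul C
      have h := ((Real.hasDerivAt_arccos hC1 hC2).comp (0 : ℝ) hin).pow 2
      have ha : Real.arccos (C * (1 - 0)) = τ := by
        rw [sub_zero, mul_one]; exact Real.arccos_cos h0.le hπ.le
      have hq : √(1 - (C * (1 - 0)) ^ 2) = Real.sin τ := by
        rw [sub_zero, mul_one, ← hSC, add_sub_cancel_right, Real.sqrt_sq hs.le]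
      refine HasDerivAt.congr_deriv h ?_
      simp only [Function.comp, ha, hq, hg]
      field_simp
      ring
    have hx : Tendsto (fun κ : ℝ => 1 - Real.cos κ) (𝓝[>] 0) (𝓝[≠] 0) := by
      refine tendsto_nhdsWithin_iff.2 ⟨?_, ?_⟩
      · have : Continuous fun κ : ℝ => 1 - Real.cos κ := by fun_prop
        simpa using (this.tendsto 0).mono_left nhdsWithin_le_nhds
      · filter_upwards [hcos1.eventually (lt_mem_nhds (by norm_num : (0 : ℝ) < 1 / 2))] with κ hκ h
        have h : 1 - Real.cos κ = 0 := h
        rw [h] at hκ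
        simp at hκ
    have h := ((hasDerivAt_iff_tendsto_slope_zero.1 hd).comp hx).mul hcos1
    rw [show 2 * g * (1 / 2) = g by ring] at h
    refine h.congr' ?_
    filter_upwards [(tendsto_nhdsWithin_iff.1 hx).2] with κ hκ
    have hκ : 1 - Real.cos κ ≠ 0 := hκ
    have e : Real.arccos (C * (1 - 0)) = τ := by
      rw [sub_zero, mul_one]; exact Real.arccos_cos h0.le hπ.le
    simp only [Function.comp, smul_eq_mul, zero_add, e, sub_sub_cancel, hW]
    field_simp
  set r : ℝ → ℝ := fun κ => -(Real.sin κ / κ) * C * (W κ / Real.sin (W κ)) with hr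
  have hT2 : Tendsto r (𝓝[>] 0) (𝓝 (-g)) := by
    have h := (hsin1.neg.mul_const C).mul
      (hWt.div ((Real.continuous_sin.tendsto τ).comp hWt) hs.ne')
    rw [show -1 * C * (τ / Real.sin τ) = -g by rw [hg]; ring] at h
    exact h
  have hT := ((hT1.add_const (1 / 2)).add hT2).sub ((hT2.pow 2).div_const 2)
  -- With `a ν = κ r` and `r → -g`, the energy excess divided by `κ²` tends to `(1 - g²) / 2`.
  have hlim : g + 1 / 2 + -g - (-g) ^ 2 / 2 < 0 := by nlinarith
  obtain ⟨κ, hκ, hκ0⟩ := ((hT.eventually (gt_mem_nhds hlim)).and self_mem_nhdsWithin).exists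
  have hκ0 : 0 < κ := hκ0
  have hsq : Real.sin (W κ) ^ 2 = 1 - (C * Real.cos κ) ^ 2 := by
    rw [hsinW, Real.sq_sqrt (hpos κ).le]
  have hSκ := Real.sin_sq_add_cos_sq κ
  have hne := (hsinpos κ).ne'
  refine ⟨κ, W κ, -(Real.sin κ * C) / Real.sin (W κ), Real.sin τ / Real.sin (W κ), ?_, ?_, ?_, ?_,
    ?_⟩
  · rw [div_pow, div_pow, ← add_div, div_eq_one_iff_eq (pow_ne_zero 2 hne), hsq]
    linear_combination hSC + C ^ 2 * hSκ
  · rw [hcosW]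
    field_simp
    linear_combination C * hSκ
  · rw [hcosW]
    field_simp
    ring
  · field_simp
  · have e : -(Real.sin κ * C) / Real.sin (W κ) * W κ = κ * r κ := by
      simp only [hr]
      field_simp
    rw [e]
    have e2 : W κ ^ 2 + κ ^ 2 / 2 + κ * (κ * r κ) - (κ * r κ) ^ 2 / 2 - τ ^ 2 =
        κ ^ 2 * ((W κ ^ 2 - τ ^ 2) / κ ^ 2 + 1 / 2 + r κ - r κ ^ 2 / 2) := by
      field_simp
      ring
    have := mul_neg_of_pos_of_neg (pow_pos hκ0 2) hκ
    linarith

namespace Block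

variable {n p : ℕ} {D : Matrix (Fin p) (Fin p) ℝ} {P N R : Matrix (Fin n) (Fin p) ℝ}

/-- The quaternionic combination `x₀ + x₁ J` of `1` and a complex structure `J`. -/
def comb (J : Matrix (Fin p) (Fin p) ℝ) (x y : ℝ) : Matrix (Fin p) (Fin p) ℝ :=
  x • 1 + y • J

theorem comb_transpose_mul {J : Matrix (Fin p) (Fin p) ℝ} (hJ : Jᵀ = -J) (hJJ : J * J = -D)
    (hDJ : D * J = J) (hJD : J * D = J) (x y x' y' : ℝ) :
    (comb J x y)ᵀ * (D * comb J x' y') = (x * x' + y * y') • D + (x * y' - y * x') • J := by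
  simp only [comb, Matrix.transpose_add, Matrix.transpose_smul, Matrix.transpose_one, hJ,
    Matrix.mul_add, Matrix.add_mul, Matrix.mul_smul, Matrix.smul_mul, Matrix.mul_one,
    Matrix.one_mul, hDJ, Matrix.neg_mul, hJD, hJJ, neg_neg]
  module

theorem hasDerivAt_frame (J : Matrix (Fin p) (Fin p) ℝ) {x₀ x₁ x₂ x₃ : ℝ → ℝ}
    {y₀ y₁ y₂ y₃ t : ℝ} (h₀ : HasDerivAt x₀ y₀ t) (h₁ : HasDerivAt x₁ y₁ t)
    (h₂ : HasDerivAt x₂ y₂ t) (h₃ : HasDerivAt x₃ y₃ t) :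
    HasDerivAt (fun t => P * comb J (x₀ t) (x₁ t) + N * comb J (x₂ t) (x₃ t) + R)
      (P * comb J y₀ y₁ + N * comb J y₂ y₃) t := by
  rw [hasDerivAt_matrix]
  intro i j
  have h := ((((h₀.mul_const (P i j)).add (h₁.mul_const ((P * J) i j)))).add
    ((h₂.mul_const (N i j)).add (h₃.mul_const ((N * J) i j)))).add_const (R i j)
  simpa [comb, Matrix.mul_add, Matrix.mul_smul] using h

theorem contDiff_frame (J : Matrix (Fin p) (Fin p) ℝ) {m : WithTop ℕ∞} {x₀ x₁ x₂ x₃ : ℝ → ℝ}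
    (h₀ : ContDiff ℝ m x₀) (h₁ : ContDiff ℝ m x₁) (h₂ : ContDiff ℝ m x₂) (h₃ : ContDiff ℝ m x₃) :
    ContDiff ℝ m (fun t => P * comb J (x₀ t) (x₁ t) + N * comb J (x₂ t) (x₃ t) + R) := by
  rw [contDiff_matrix]
  intro i j
  simp only [comb, Matrix.mul_add, Matrix.mul_smul, Matrix.mul_one, Matrix.add_apply,
    Matrix.smul_apply, smul_eq_mul]
  fun_prop

theorem comb_frame_mem (h : Block D P N R) {J : Matrix (Fin p) (Fin p) ℝ} (hJ : Jᵀ = -J)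
    (hJJ : J * J = -D) (hDJ : D * J = J) (hJD : J * D = J) {x₀ x₁ x₂ x₃ : ℝ}
    (hx : x₀ ^ 2 + x₁ ^ 2 + x₂ ^ 2 + x₃ ^ 2 = 1) :
    P * comb J x₀ x₁ + N * comb J x₂ x₃ + R ∈ manifold n p := by
  refine h.frame_mem ?_
  rw [comb_transpose_mul hJ hJJ hDJ hJD, comb_transpose_mul hJ hJJ hDJ hJD]
  trans (x₀ ^ 2 + x₁ ^ 2 + x₂ ^ 2 + x₃ ^ 2) • D
  · module
  · rw [hx, one_smul]

/-- For `y` orthogonal to `x`, the product `Xᵀ ξ` is the Hopf component of `y` times `J`. So the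
parameter `β` rescales only the Hopf fibres. -/
theorem comb_frame_speed (h : Block D P N R) (β : ℝ) {J : Matrix (Fin p) (Fin p) ℝ} (hJ : Jᵀ = -J)
    (hJJ : J * J = -D) (hDJ : D * J = J) (hJD : J * D = J) {x₀ x₁ x₂ x₃ y₀ y₁ y₂ y₃ : ℝ}
    (hxy : x₀ * y₀ + x₁ * y₁ + x₂ * y₂ + x₃ * y₃ = 0) :
    metric β (P * comb J x₀ x₁ + N * comb J x₂ x₃ + R) (P * comb J y₀ y₁ + N * comb J y₂ y₃)
      (P * comb J y₀ y₁ + N * comb J y₂ y₃) =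
      (y₀ ^ 2 + y₁ ^ 2 + y₂ ^ 2 + y₃ ^ 2
        - (1 - β) * (x₀ * y₁ - x₁ * y₀ + x₂ * y₃ - x₃ * y₂) ^ 2) * D.trace := by
  rw [h.speed]
  simp only [comb_transpose_mul hJ hJJ hDJ hJD]
  have e1 : (x₀ * y₀ + x₁ * y₁) • D + (x₀ * y₁ - x₁ * y₀) • J +
      ((x₂ * y₂ + x₃ * y₃) • D + (x₂ * y₃ - x₃ * y₂) • J) =
      (x₀ * y₁ - x₁ * y₀ + x₂ * y₃ - x₃ * y₂) • J := by
    trans (x₀ * y₀ + x₁ * y₁ + x₂ * y₂ + x₃ * y₃) • D +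
      (x₀ * y₁ - x₁ * y₀ + x₂ * y₃ - x₃ * y₂) • J
    · module
    · rw [hxy, zero_smul, zero_add]
  have e2 : J.trace = 0 := by
    have := Matrix.trace_transpose J
    rw [hJ, Matrix.trace_neg] at this
    linarith
  rw [e1]
  simp only [Matrix.transpose_smul, hJ, Matrix.smul_mul, Matrix.mul_smul, Matrix.neg_mul, hJJ,
    neg_neg, smul_neg, Matrix.trace_add, Matrix.trace_smul, e2, smul_eq_mul]
  ring

/-- A rank-two block with a complex structure contains a squashed three-sphere. -/
theorem injRadius_le_of_complex (h : Block D P N R) (hD : D.trace = 2) {J : Matrix (Fin p) (Fin p) ℝ}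
    (hJ : Jᵀ = -J) (hJJ : J * J = -D) (hDJ : D * J = J) (hJD : J * D = J) {τ : ℝ} (hτ : 0 < τ)
    (hτπ : τ < Real.pi) (hneg : ∀ t, τ < t → t ≤ Real.pi → conjFun t < 0) :
    injRadius (1 / 2) n p ≤ ENNReal.ofReal (τ * √2) := by
  have hs2 : (0 : ℝ) < √2 := by positivity
  have hs2' : √2 ^ 2 = (2 : ℝ) := Real.sq_sqrt zero_le_two
  have hs : ∀ t, metric (1 / 2) (arc P N R (√2)⁻¹ t) (deriv (arc P N R (√2)⁻¹) t)
      (deriv (arc P N R (√2)⁻¹) t) = 1 := fun t => by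
    rw [h.arc_speed, hD, inv_pow, hs2']; norm_num
  refine injRadius_le (h.isGeodesic_arc _ _) (h.deriv_arc_mem_tangentSpace _ 0) (hs 0)
    (cutTime_le (contDiff_arc _) (h.arc_mem _) hs fun b hb => ?_)
  have hb : τ < b / √2 := (lt_div_iff₀ hs2).2 hb
  obtain ⟨θ, hθ1, hθ2⟩ := exists_between (lt_min hb hτπ)
  rw [lt_min_iff] at hθ2
  have hθ0 : 0 < θ := hτ.trans hθ1
  obtain ⟨κ, ν, a, c, hac, hx0, hx1, hc, hE⟩ :=
    exists_shorter_orbit hθ0 hθ2.2 (hneg θ hθ1 hθ2.2.le)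
  set E := ν ^ 2 + κ ^ 2 / 2 + κ * (a * ν) - (a * ν) ^ 2 / 2 with hEdef
  have hE0 : 0 ≤ E := by
    have : E = (c * ν) ^ 2 + (κ + a * ν) ^ 2 / 2 := by
      rw [hEdef]; linear_combination -ν ^ 2 * hac
    rw [this]; positivity
  have hdk : ∀ k t : ℝ, HasDerivAt (fun t => k * t) k t := fun k t => by
    simpa using (hasDerivAt_id t).const_mul k
  have hdk1 : ∀ k t : ℝ, HasDerivAt (fun t => k * (t - 1)) k t := fun k t => by
    simpa using ((hasDerivAt_id t).sub_const 1).const_mul k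
  -- In complex form, `x₀ + i x₁ = e^{iκt} (cos νt + i a sin νt)` and `x₂ + i x₃ = c e^{iκ(t-1)} sin
  -- νt`: a Hopf rotation applied to a great circle. The shift `t - 1` makes `x₃` vanish at the
  -- endpoint.
  set x₀ : ℝ → ℝ := fun t =>
    Real.cos (κ * t) * Real.cos (ν * t) - a * (Real.sin (κ * t) * Real.sin (ν * t)) with hx₀
  set x₁ : ℝ → ℝ := fun t =>
    Real.sin (κ * t) * Real.cos (ν * t) + a * (Real.cos (κ * t) * Real.sin (ν * t)) with hx₁
  set x₂ : ℝ → ℝ := fun t => c * (Real.sin (ν * t) * Real.cos (κ * (t - 1))) with hx₂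
  set x₃ : ℝ → ℝ := fun t => c * (Real.sin (ν * t) * Real.sin (κ * (t - 1))) with hx₃
  have hd₀ : ∀ t, HasDerivAt x₀ _ t := fun t =>
    ((hdk κ t).cos.mul (hdk ν t).cos).sub (((hdk κ t).sin.mul (hdk ν t).sin).const_mul a)
  have hd₁ : ∀ t, HasDerivAt x₁ _ t := fun t =>
    ((hdk κ t).sin.mul (hdk ν t).cos).add (((hdk κ t).cos.mul (hdk ν t).sin).const_mul a)
  have hd₂ : ∀ t, HasDerivAt x₂ _ t := fun t => ((hdk ν t).sin.mul (hdk1 κ t).cos).const_mul c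
  have hd₃ : ∀ t, HasDerivAt x₃ _ t := fun t => ((hdk ν t).sin.mul (hdk1 κ t).sin).const_mul c
  refine ⟨√2 * θ, √2 * √E, fun t => P * comb J (x₀ t) (x₁ t) + N * comb J (x₂ t) (x₃ t) + R,
    ?_, ?_, fun t => ?_, by positivity, ?_, fun t => ?_, ?_, ?_⟩
  · rw [mul_comm]; exact (lt_div_iff₀ hs2).1 hθ2.1
  · exact contDiff_frame J (by fun_prop) (by fun_prop) (by fun_prop) (by fun_prop)
  · refine h.comb_frame_mem hJ hJJ hDJ hJD ?_
    have e1 := Real.sin_sq_add_cos_sq (κ * t)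
    have e2 := Real.sin_sq_add_cos_sq (ν * t)
    have e3 := Real.sin_sq_add_cos_sq (κ * (t - 1))
    simp only [hx₀, hx₁, hx₂, hx₃]
    linear_combination (Real.cos (ν * t) ^ 2 + a ^ 2 * Real.sin (ν * t) ^ 2) * e1
      + c ^ 2 * Real.sin (ν * t) ^ 2 * e3 + Real.sin (ν * t) ^ 2 * hac + e2
  · gcongr
    rw [Real.sqrt_lt' hθ0]
    exact hE
  · have hd : deriv (fun t => P * comb J (x₀ t) (x₁ t) + N * comb J (x₂ t) (x₃ t) + R) t = _ :=
      (hasDerivAt_frame (P := P) (N := N) (R := R) J (hd₀ t) (hd₁ t) (hd₂ t) (hd₃ t)).deriv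
    have e1 := Real.sin_sq_add_cos_sq (κ * t)
    have e2 := Real.sin_sq_add_cos_sq (ν * t)
    have e3 := Real.sin_sq_add_cos_sq (κ * (t - 1))
    rw [mul_pow, hs2', Real.sq_sqrt hE0, mul_comm 2 E, hd]
    simp only [hx₀, hx₁, hx₂, hx₃]
    generalize Real.sin (κ * t) = sk at *
    generalize Real.cos (κ * t) = ck at *
    generalize Real.sin (ν * t) = sn at *
    generalize Real.cos (ν * t) = cn at *
    generalize Real.sin (κ * (t - 1)) = sl at *
    generalize Real.cos (κ * (t - 1)) = cl at *
    rw [h.comb_frame_speed _ hJ hJJ hDJ hJD, hD, hEdef]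
    · congr 1
      -- `A` is the squared Euclidean speed and `B` the Hopf component of the velocity; both are
      -- constant along the orbit.
      have hy : ∀ A B S : ℝ, A = κ ^ 2 + ν ^ 2 + 2 * κ * (a * ν) → B = κ + a * ν →
          S = A - (1 - 1 / 2) * B ^ 2 →
          S = ν ^ 2 + κ ^ 2 / 2 + κ * (a * ν) - (a * ν) ^ 2 / 2 := by
        rintro A B S rfl rfl rfl
        ring
      refine hy _ _ _ ?_ ?_ rfl
      · linear_combination (κ ^ 2 * (cn ^ 2 + a ^ 2 * sn ^ 2) + ν ^ 2 * (sn ^ 2 + a ^ 2 * cn ^ 2)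
          + 2 * κ * a * ν * (sn ^ 2 + cn ^ 2)) * e1
          + c ^ 2 * (κ ^ 2 * sn ^ 2 + ν ^ 2 * cn ^ 2) * e3
          + (κ ^ 2 * sn ^ 2 + ν ^ 2 * cn ^ 2) * hac + (κ ^ 2 + ν ^ 2 + 2 * κ * a * ν) * e2
      · linear_combination (κ * (cn ^ 2 + a ^ 2 * sn ^ 2) + a * ν * (sn ^ 2 + cn ^ 2)) * e1
          + κ * c ^ 2 * sn ^ 2 * e3 + κ * sn ^ 2 * hac + (κ + a * ν) * e2
    · linear_combination (a ^ 2 - 1) * ν * sn * cn * e1 + c ^ 2 * ν * sn * cn * e3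
        + ν * sn * cn * hac
  · rw [arc_zero]
    simp [hx₀, hx₁, hx₂, hx₃, comb]
  · simp only [hx₀, hx₁, hx₂, hx₃, mul_one, hx0, hx1, sub_self, mul_zero, Real.cos_zero,
      Real.sin_zero, comb, hc, arc, zero_smul, add_zero, inv_mul_cancel_left₀ hs2.ne']

end Block

theorem injRadius_canonical_le {n p : ℕ} (hp : 2 ≤ p) (hn : p + 2 ≤ n) {τ : ℝ} (hτ : 0 < τ)
    (hτπ : τ < Real.pi) (hneg : ∀ t, τ < t → t ≤ Real.pi → conjFun t < 0) :
    injRadius (1 / 2) n p ≤ ENNReal.ofReal (τ * √2) := by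
  obtain ⟨P, N, R, h⟩ := exists_block hn
  set i : Fin p := ⟨0, by omega⟩ with hi
  set j : Fin p := ⟨1, by omega⟩ with hj
  have hij : i ≠ j := by simp [hi, hj]
  set D : Matrix (Fin p) (Fin p) ℝ := Matrix.diagonal fun j => if j.val < 2 then 1 else 0 with hD
  have hD' : D = Matrix.single i i 1 + Matrix.single j j 1 := by
    ext a b
    simp only [hD, Matrix.diagonal_apply, Matrix.add_apply, Matrix.single_apply, hi, hj, Fin.ext_iff]
    split_ifs <;> first | omega | norm_num
  -- The complex structure is the quarter turn of the first two coordinates.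
  refine h.injRadius_le_of_complex (J := Matrix.single j i 1 - Matrix.single i j 1) ?_ ?_ ?_ ?_ ?_
    hτ hτπ hneg
  · rw [hD, trace_diagonal_lt hp]; norm_num
  · simp
  · rw [hD']
    simp [Matrix.sub_mul, Matrix.mul_sub, hij, hij.symm]
    abel
  · rw [hD']
    simp [Matrix.add_mul, Matrix.mul_sub, hij, hij.symm]
    try abel
  · rw [hD']
    simp [Matrix.sub_mul, Matrix.mul_add, hij, hij.symm]
    try abel

/-! ### Conserved momentum of canonical geodesics. -/

section Momentum

variable {n p : ℕ}

/-- The skew-symmetric matrix `M` with `M X = ξ` that generates the geodesic of the canonical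
metric with initial velocity `ξ` at `X`. -/
def momentum (X ξ : Matrix (Fin n) (Fin p) ℝ) : Matrix (Fin n) (Fin n) ℝ :=
  ξ * Xᵀ - X * ξᵀ + X * (ξᵀ * X * Xᵀ)

theorem momentum_skew {X ξ : Matrix (Fin n) (Fin p) ℝ} (hξ : ξ ∈ tangentSpace X) :
    (momentum X ξ)ᵀ = -momentum X ξ := by
  have h : Xᵀ * ξ = -(ξᵀ * X) := eq_neg_of_add_eq_zero_left hξ
  simp only [momentum, Matrix.transpose_add, Matrix.transpose_sub, Matrix.transpose_mul,
    Matrix.transpose_transpose, h, Matrix.neg_mul, Matrix.mul_neg, Matrix.mul_assoc]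
  abel

theorem momentum_mul {X ξ : Matrix (Fin n) (Fin p) ℝ} (hX : X ∈ manifold n p) :
    momentum X ξ * X = ξ := by
  have hX : Xᵀ * X = 1 := hX
  simp only [momentum, Matrix.add_mul, Matrix.sub_mul, Matrix.mul_assoc, hX, Matrix.mul_one]
  abel

/-- For `ξ = X A + X⊥ H` the momentum has, in the basis `[X X⊥]`, the blocks `A`, `-Hᵀ`, `H`, `0`.
Its squared norm is therefore `|A|² + 2 |H|²`, twice the canonical metric. -/
theorem trace_momentum {X ξ : Matrix (Fin n) (Fin p) ℝ} (hX : X ∈ manifold n p)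
    (hξ : ξ ∈ tangentSpace X) :
    ((momentum X ξ)ᵀ * momentum X ξ).trace = 2 * metric (1 / 2) X ξ ξ := by
  have hM := momentum_mul (ξ := ξ) hX
  have hs := momentum_skew hξ
  have h : Xᵀ * ξ = -(ξᵀ * X) := eq_neg_of_add_eq_zero_left hξ
  have h1 : (momentum X ξ)ᵀ * momentum X ξ = -(momentum X ξ * ξ * Xᵀ) + ξ * ξᵀ
      - ξ * (ξᵀ * X * Xᵀ) := by
    conv_lhs => rw [hs]; arg 2; rw [momentum]
    simp only [Matrix.neg_mul, Matrix.mul_add, Matrix.mul_sub, ← Matrix.mul_assoc, hM]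
    abel
  have h2 : Xᵀ * (momentum X ξ * ξ) = -(ξᵀ * ξ) := by
    rw [← Matrix.mul_assoc]
    have : Xᵀ * momentum X ξ = -ξᵀ := by
      have e := congrArg Matrix.transpose hM
      rw [Matrix.transpose_mul, hs, Matrix.mul_neg] at e
      rw [← e, neg_neg]
    rw [this, Matrix.neg_mul]
  rw [h1, metric_self, h]
  simp only [Matrix.trace_add, Matrix.trace_sub, Matrix.trace_neg]
  rw [Matrix.trace_mul_comm, h2, Matrix.trace_mul_comm ξ ξᵀ, Matrix.trace_mul_comm ξ]
  have h3 : (ξᵀ * X * Xᵀ * ξ).trace = -((-(ξᵀ * X))ᵀ * -(ξᵀ * X)).trace * -1 := by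
    have : (-(ξᵀ * X))ᵀ = ξᵀ * X := by
      rw [← h, Matrix.transpose_mul, Matrix.transpose_transpose]
    rw [this, Matrix.mul_assoc, h]
    simp
  rw [h3, Matrix.trace_neg]
  ring

theorem deriv_mem_tangentSpace {c : ℝ → Matrix (Fin n) (Fin p) ℝ} {ξ : Matrix (Fin n) (Fin p) ℝ}
    {t : ℝ} (hm : ∀ᶠ s in nhds t, c s ∈ manifold n p) (hd : HasDerivAt c ξ t) :
    ξ ∈ tangentSpace (c t) := by
  have h1 := hasDerivAt_matrix_mul (hasDerivAt_matrix_transpose hd) hd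
  have h2 : HasDerivAt (fun s => (c s)ᵀ * c s) 0 t := by
    refine HasDerivAt.congr_of_eventuallyEq (hasDerivAt_const t (1 : Matrix (Fin p) (Fin p) ℝ)) ?_
    filter_upwards [hm] with s hs using hs
  change _ + _ = 0
  rw [add_comm]
  exact h1.unique h2

end Momentum

theorem matrix_hasDerivAt_deriv {n p : ℕ} {γ : ℝ → Matrix (Fin n) (Fin p) ℝ}
    (hγ : ContDiff ℝ ∞ γ) (t : ℝ) : HasDerivAt γ (deriv γ t) t :=
  ((hγ.differentiable (by simp)) t).hasDerivAt

theorem matrix_hasDerivAt_deriv_deriv {n p : ℕ} {γ : ℝ → Matrix (Fin n) (Fin p) ℝ}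
    (hγ : ContDiff ℝ ∞ γ) (t : ℝ) : HasDerivAt (deriv γ) (deriv (deriv γ) t) t := by
  have h : ContDiff ℝ ∞ (deriv γ) := (contDiff_infty_iff_deriv.1 hγ).2
  exact matrix_hasDerivAt_deriv h t

theorem matrix_eq_zero_of_trace {m : ℕ} {B : Matrix (Fin m) (Fin m) ℝ}
    (h : (Bᵀ * B).trace = 0) : B = 0 := by
  rw [← Matrix.conjTranspose_eq_transpose_of_trivial] at h
  exact Matrix.trace_conjTranspose_mul_self_eq_zero_iff.1 h

namespace IsGeodesic

variable {n p : ℕ} {γ : ℝ → Matrix (Fin n) (Fin p) ℝ}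

theorem velocity_mem {β : ℝ} (h : IsGeodesic β γ) (t : ℝ) : deriv γ t ∈ tangentSpace (γ t) :=
  deriv_mem_tangentSpace (Filter.Eventually.of_forall h.2.1) (matrix_hasDerivAt_deriv h.1 t)

/-- The derivative `B` of the momentum is skew, so `B γ` is tangent. Testing the geodesic equation
against this vector gives `tr (B²) = 0`, that is `|B|² = 0`. -/
theorem hasDerivAt_momentum (h : IsGeodesic (1 / 2) γ) (t : ℝ) :
    HasDerivAt (fun s => momentum (γ s) (deriv γ s)) 0 t := by
  have hV := matrix_hasDerivAt_deriv h.1 t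
  have hA := matrix_hasDerivAt_deriv_deriv h.1 t
  have hVT := hasDerivAt_matrix_transpose hV
  have hAT := hasDerivAt_matrix_transpose hA
  have hB : HasDerivAt (fun s => momentum (γ s) (deriv γ s)) _ t :=
    ((hasDerivAt_matrix_mul hA hVT).sub (hasDerivAt_matrix_mul hV hAT)).add
      (hasDerivAt_matrix_mul hV (hasDerivAt_matrix_mul (hasDerivAt_matrix_mul hAT hV) hVT))
  obtain ⟨B, hBe, hB⟩ : ∃ B, B = _ ∧ HasDerivAt (fun s => momentum (γ s) (deriv γ s)) B t :=
    ⟨_, rfl, hB⟩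
  have hskew : Bᵀ = -B := by
    refine (hasDerivAt_matrix_transpose hB).unique (hB.neg.congr_of_eventuallyEq ?_)
    exact Filter.Eventually.of_forall fun s => momentum_skew (h.velocity_mem s)
  have hηT : B * γ t ∈ tangentSpace (γ t) := by
    change (γ t)ᵀ * (B * γ t) + (B * γ t)ᵀ * γ t = 0
    rw [Matrix.transpose_mul, hskew, Matrix.mul_neg, Matrix.neg_mul, Matrix.mul_assoc,
      add_neg_cancel]
  have hg := h.2.2 t _ hηT
  rw [covariantAcceleration_eq] at hg
  have hBB : (B * B).trace = 0 := by
    have hcyc : ∀ (Z : Matrix (Fin n) (Fin p) ℝ) (Y : Matrix (Fin p) (Fin n) ℝ),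
        (B * (Z * Y)).trace = (Y * (B * Z)).trace := fun Z Y => by
      rw [← Matrix.mul_assoc, Matrix.trace_mul_comm]
    have htr : ∀ Z : Matrix (Fin n) (Fin n) ℝ, (B * Z).trace = -(B * Zᵀ).trace := fun Z => by
      rw [← Matrix.trace_transpose, Matrix.transpose_mul, hskew, Matrix.mul_neg, Matrix.trace_neg,
        Matrix.trace_mul_comm]
    refine (congrArg (fun Z => (B * Z).trace) hBe).trans ?_
    simp only [Matrix.mul_add, Matrix.add_mul, Matrix.mul_sub, Matrix.trace_add, Matrix.trace_sub]
    rw [htr (deriv (deriv γ) t * (γ t)ᵀ), htr (deriv γ t * ((deriv γ t)ᵀ * γ t * (γ t)ᵀ))]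
    simp only [Matrix.transpose_mul, Matrix.transpose_transpose, hcyc, Matrix.mul_assoc] at hg ⊢
    have hcyc' := Matrix.trace_mul_comm ((γ t)ᵀ * deriv γ t) ((deriv γ t)ᵀ * (B * γ t))
    simp only [Matrix.mul_assoc] at hcyc'
    linear_combination (-2) * hg - hcyc'
  have : B = 0 := by
    refine matrix_eq_zero_of_trace ?_
    rw [hskew, Matrix.neg_mul, Matrix.trace_neg, hBB, neg_zero]
  rw [this] at hB
  exact hB

theorem momentum_eq (h : IsGeodesic (1 / 2) γ) (t : ℝ) :
    momentum (γ t) (deriv γ t) = momentum (γ 0) (deriv γ 0) := by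
  ext i j
  have hd := fun s => hasDerivAt_matrix.1 (h.hasDerivAt_momentum s) i j
  exact is_const_of_deriv_eq_zero (fun s => (hd s).differentiableAt) (fun s => (hd s).deriv) t 0

theorem deriv_eq_momentum_mul (h : IsGeodesic (1 / 2) γ) (t : ℝ) :
    deriv γ t = momentum (γ 0) (deriv γ 0) * γ t := by
  rw [← h.momentum_eq t, momentum_mul (h.2.1 t)]

theorem metric_eq_one (h : IsGeodesic (1 / 2) γ)
    (h1 : metric (1 / 2) (γ 0) (deriv γ 0) (deriv γ 0) = 1) (t : ℝ) :
    metric (1 / 2) (γ t) (deriv γ t) (deriv γ t) = 1 := by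
  have e0 := trace_momentum (h.2.1 0) (h.velocity_mem 0)
  have et := trace_momentum (h.2.1 t) (h.velocity_mem t)
  rw [h.momentum_eq t, e0, h1] at et
  linarith

end IsGeodesic

/-! ### Scalar tools for the lower bounds. -/

/-- The energy of the difference with the cosine is conserved and starts at zero. For `μ = 0` it
controls only the velocity, so the difference itself is then shown to be constant. -/
theorem eq_cos_of_hasDerivAt {μ : ℝ} {y z : ℝ → ℝ} (hy : ∀ t, HasDerivAt y (z t) t)
    (hz : ∀ t, HasDerivAt z (-μ ^ 2 * y t) t) (hy0 : y 0 = 1) (hz0 : z 0 = 0) (t : ℝ) :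
    y t = Real.cos (μ * t) := by
  have hm : ∀ t, HasDerivAt (fun t => μ * t) μ t := fun t => by
    simpa using (hasDerivAt_id t).const_mul μ
  have he : ∀ t, HasDerivAt (fun t => y t - Real.cos (μ * t)) (z t + μ * Real.sin (μ * t)) t :=
    fun t => ((hy t).sub (hm t).cos).congr_deriv (by ring)
  have hd : ∀ t, HasDerivAt (fun t => z t + μ * Real.sin (μ * t))
      (-μ ^ 2 * (y t - Real.cos (μ * t))) t :=
    fun t => ((hz t).add ((hm t).sin.const_mul μ)).congr_deriv (by ring)
  have hE : ∀ t, HasDerivAt (fun t => (z t + μ * Real.sin (μ * t)) ^ 2 +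
      μ ^ 2 * (y t - Real.cos (μ * t)) ^ 2) 0 t := fun t =>
    (((hd t).pow 2).add (((he t).pow 2).const_mul (μ ^ 2))).congr_deriv (by push_cast; ring)
  have hE0 : ∀ t, (z t + μ * Real.sin (μ * t)) ^ 2 + μ ^ 2 * (y t - Real.cos (μ * t)) ^ 2 = 0 :=
    fun t => by
      have := is_const_of_deriv_eq_zero (fun s => (hE s).differentiableAt) (fun s => (hE s).deriv)
        t 0
      rw [this, hy0, hz0]
      simp
  have hd0 : ∀ t, z t + μ * Real.sin (μ * t) = 0 := fun t => by
    have := hE0 t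
    have h2 : 0 ≤ μ ^ 2 * (y t - Real.cos (μ * t)) ^ 2 := by positivity
    exact pow_eq_zero_iff two_ne_zero |>.1 (le_antisymm (by linarith) (sq_nonneg _))
  have := is_const_of_deriv_eq_zero (fun s => (he s).differentiableAt)
    (fun s => (he s).deriv.trans (hd0 s)) t 0
  simp only [hy0, mul_zero, Real.cos_zero, sub_self] at this
  linarith

/-- The function `arccos (r q)` is a smooth approximation of the spherical distance `arccos q`, and
is no more expanding. -/
theorem exists_hasDerivAt_arccos_mul {q : ℝ → ℝ} {q' Y r t : ℝ} (hq : HasDerivAt q q' t)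
    (hr0 : 0 ≤ r) (hr1 : r < 1) (hq1 : q t ^ 2 ≤ 1) (hY : q' ^ 2 ≤ Y * (1 - q t ^ 2)) (hY0 : 0 ≤ Y) :
    ∃ k, HasDerivAt (fun s => Real.arccos (r * q s)) k t ∧ k ≤ √Y := by
  have hr2 : r ^ 2 < 1 := by nlinarith
  have hlt : (r * q t) ^ 2 < 1 := by
    rw [mul_pow]; nlinarith [sq_nonneg r]
  have hd := (Real.hasDerivAt_arccos (x := r * q t) (by nlinarith) (by nlinarith)).comp t
    (hq.const_mul r)
  refine ⟨_, hd, ?_⟩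
  refine Real.le_sqrt_of_sq_le ?_
  rw [mul_pow, neg_sq, div_pow, Real.sq_sqrt (by linarith), one_pow, one_div,
    inv_mul_le_iff₀ (by linarith), mul_pow]
  have h1 : r ^ 2 * q' ^ 2 ≤ r ^ 2 * (Y * (1 - q t ^ 2)) := by gcongr
  have h2 : 0 ≤ Y * (1 - r ^ 2) := mul_nonneg hY0 (by linarith)
  nlinarith

/-- Cauchy–Schwarz for `y` and the component of `u` orthogonal to `x`. It says that the spherical
distance from `u` grows at most at unit rate. -/
theorem dotProduct_sq_le {ι : Type*} [Fintype ι] {u x y : ι → ℝ} (hu : u ⬝ᵥ u = 1)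
    (hx : x ⬝ᵥ x = 1) (hxy : x ⬝ᵥ y = 0) :
    (u ⬝ᵥ y) ^ 2 ≤ (y ⬝ᵥ y) * (1 - (u ⬝ᵥ x) ^ 2) := by
  have h := Finset.sum_mul_sq_le_sq_mul_sq Finset.univ (u - (u ⬝ᵥ x) • x) y
  have e1 : ∑ i, (u - (u ⬝ᵥ x) • x) i * y i = u ⬝ᵥ y := by
    change (u - (u ⬝ᵥ x) • x) ⬝ᵥ y = _
    rw [sub_dotProduct, smul_dotProduct, hxy, smul_zero, sub_zero]
  have e2 : ∑ i, (u - (u ⬝ᵥ x) • x) i ^ 2 = 1 - (u ⬝ᵥ x) ^ 2 := by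
    simp only [sq ((u - (u ⬝ᵥ x) • x) _)]
    change (u - (u ⬝ᵥ x) • x) ⬝ᵥ (u - (u ⬝ᵥ x) • x) = _
    rw [sub_dotProduct, dotProduct_sub, dotProduct_sub, smul_dotProduct, smul_dotProduct,
      dotProduct_smul, dotProduct_smul, hu, hx, dotProduct_comm x u]
    simp only [smul_eq_mul]
    ring
  have e3 : ∑ i, y i ^ 2 = y ⬝ᵥ y := by
    simp only [dotProduct, sq]
  rw [e1, e2, e3, mul_comm] at h
  exact h

theorem dotProduct_sq_le_one {ι : Type*} [Fintype ι] {u x : ι → ℝ} (hu : u ⬝ᵥ u = 1)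
    (hx : x ⬝ᵥ x = 1) : (u ⬝ᵥ x) ^ 2 ≤ 1 := by
  have h := Finset.sum_mul_sq_le_sq_mul_sq Finset.univ u x
  simp only [sq (u _), sq (x _)] at h
  change (u ⬝ᵥ x) ^ 2 ≤ (u ⬝ᵥ u) * (x ⬝ᵥ x) at h
  rwa [hu, hx, one_mul] at h

/-- The cut time is a supremum, so minimality at the single time `b` suffices; the geodesic itself
gives the other inequality for the distance. -/
theorem le_cutTime {n p : ℕ} {β b : ℝ} {γ : ℝ → Matrix (Fin n) (Fin p) ℝ} (hγ : IsGeodesic β γ)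
    (hs : ∀ t, metric β (γ t) (deriv γ t) (deriv γ t) = 1) (hb : 0 < b)
    (hc : ∀ c : ℝ → Matrix (Fin n) (Fin p) ℝ, IsPiecewiseC1Curve c → c 0 = γ 0 → c 1 = γ b →
      b ≤ curveLength β c) :
    ENNReal.ofReal b ≤ cutTime β γ := by
  refine le_iSup₂_of_le b ⟨hb, le_antisymm ?_ ?_⟩ le_rfl
  · have h := riemannianDist_le (c := fun s => γ (0 + b * s))
      ((hγ.1.of_le (by exact_mod_cast le_top)).comp (by fun_prop)) (fun s => hγ.2.1 _) hb.le
      (speed_comp_affine hs 0 b)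
    simpa using h
  · exact le_iInf₂ fun c h => ENNReal.ofReal_le_ofReal (hc c h.1 h.2.1 h.2.2)

theorem le_of_forall_lt_one {F : ℝ → ℝ} {L : ℝ} (hF : Continuous F)
    (h : ∀ r, 0 ≤ r → r < 1 → F r ≤ L) : F 1 ≤ L := by
  refine le_of_tendsto ((hF.tendsto 1).mono_left (nhdsWithin_le_nhds (s := Set.Iio 1))) ?_
  filter_upwards [Ioo_mem_nhdsLT (zero_lt_one : (0 : ℝ) < 1)] with r hr using h r hr.1.le hr.2

/-! ### Lower bound for the sphere, `p = 1`. -/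

section Sphere

variable {n : ℕ}

theorem transpose_mul_eq_zero {X η : Matrix (Fin n) (Fin 1) ℝ} (h : η ∈ tangentSpace X) :
    Xᵀ * η = 0 := by
  have hs := transpose_mul_skew h
  ext i j
  have := congrFun (congrFun hs i) j
  rw [Subsingleton.elim j i] at this ⊢
  rw [Matrix.transpose_apply, Matrix.neg_apply] at this
  rw [Matrix.zero_apply]
  linarith

theorem transpose_mul_eq_zero' {X η : Matrix (Fin n) (Fin 1) ℝ} (h : η ∈ tangentSpace X) :
    ηᵀ * X = 0 := by
  simpa using congrArg Matrix.transpose (transpose_mul_eq_zero h)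

theorem metric_sphere (β : ℝ) {X ξ : Matrix (Fin n) (Fin 1) ℝ} (h : ξ ∈ tangentSpace X) :
    metric β X ξ ξ = (ξᵀ * ξ) 0 0 := by
  rw [metric_self, transpose_mul_eq_zero h]
  simp [Matrix.trace]

/-- For one column, tangency means `Xᵀ η = 0`, so all terms with `β` vanish. This makes the
conserved momentum available for every `β`. -/
theorem IsGeodesic.sphere {β β' : ℝ} {γ : ℝ → Matrix (Fin n) (Fin 1) ℝ} (h : IsGeodesic β γ) :
    IsGeodesic β' γ := by
  refine ⟨h.1, h.2.1, fun t η hη => ?_⟩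
  have hg := h.2.2 t η hη
  rw [covariantAcceleration_eq] at hg ⊢
  rw [transpose_mul_eq_zero hη, transpose_mul_eq_zero (h.velocity_mem t),
    transpose_mul_eq_zero' (h.velocity_mem t)] at hg ⊢
  simpa using hg

theorem cos_of_isGeodesic_sphere {β : ℝ} {γ : ℝ → Matrix (Fin n) (Fin 1) ℝ} (h : IsGeodesic β γ)
    (h1 : ∀ t, metric β (γ t) (deriv γ t) (deriv γ t) = 1) (t : ℝ) :
    ((γ 0)ᵀ * γ t) 0 0 = Real.cos t := by
  have hcan : IsGeodesic (1 / 2) γ := h.sphere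
  set M := momentum (γ 0) (deriv γ 0) with hM
  have hd : ∀ t, HasDerivAt γ (M * γ t) t := fun t => by
    have := matrix_hasDerivAt_deriv h.1 t
    rw [hcan.deriv_eq_momentum_mul t] at this
    exact this
  -- By conservation, `M = γ' γᵀ - γ γ'ᵀ` at every time, a quarter turn in the plane of `γ` and the
  -- unit vector `γ'`.
  have hMM : ∀ t, M * (M * γ t) = -γ t := fun t => by
    rw [← hcan.deriv_eq_momentum_mul t, hM, ← hcan.momentum_eq t, momentum,
      transpose_mul_eq_zero' (h.velocity_mem t)]
    have e : (deriv γ t)ᵀ * deriv γ t = 1 := by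
      ext i j
      rw [Subsingleton.elim i 0, Subsingleton.elim j 0, ← metric_sphere β (h.velocity_mem t), h1]
      simp
    rw [Matrix.zero_mul, Matrix.mul_zero, add_zero, Matrix.sub_mul, Matrix.mul_assoc,
      Matrix.mul_assoc, e, transpose_mul_eq_zero (h.velocity_mem t)]
    simp
  have hy : ∀ t, HasDerivAt (fun t => ((γ 0)ᵀ * γ t) 0 0) (((γ 0)ᵀ * (M * γ t)) 0 0) t := fun t => by
    have := hasDerivAt_matrix.1 (hasDerivAt_matrix_mul (hasDerivAt_const t (γ 0)ᵀ) (hd t)) 0 0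
    simpa using this
  have hz : ∀ t, HasDerivAt (fun t => ((γ 0)ᵀ * (M * γ t)) 0 0)
      (-1 ^ 2 * ((γ 0)ᵀ * γ t) 0 0) t := fun t => by
    have := hasDerivAt_matrix.1 (hasDerivAt_matrix_mul (hasDerivAt_const t (γ 0)ᵀ)
      (hasDerivAt_matrix_mul (hasDerivAt_const t M) (hd t))) 0 0
    simpa [hMM] using this
  have h0 : (γ 0)ᵀ * γ 0 = 1 := h.2.1 0
  have := eq_cos_of_hasDerivAt hy hz (by rw [h0]; rfl) (by
    rw [hM, momentum_mul (h.2.1 0), transpose_mul_eq_zero (h.velocity_mem 0)]; rfl) t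
  rwa [one_mul] at this

theorem pi_le_injRadius_sphere (β : ℝ) : ENNReal.ofReal Real.pi ≤ injRadius β n 1 := by
  refine le_injRadius fun γ hγ hT hs0 => ?_
  have hs : ∀ t, metric β (γ t) (deriv γ t) (deriv γ t) = 1 := fun t => by
    rw [metric_sphere β hT, ← metric_sphere (1 / 2) hT] at hs0
    have hcan : IsGeodesic (1 / 2) γ := hγ.sphere
    rw [metric_sphere β (hγ.velocity_mem t), ← metric_sphere (1 / 2) (hγ.velocity_mem t)]
    exact hcan.metric_eq_one hs0 t
  refine le_cutTime hγ hs Real.pi_pos fun c hc hc0 hc1 => ?_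
  set X := γ 0 with hX
  have hdot : ∀ A B : Matrix (Fin n) (Fin 1) ℝ,
      (Aᵀ * B) 0 0 = (fun i => A i 0) ⬝ᵥ fun i => B i 0 := fun A B => rfl
  have hone : ∀ Z ∈ manifold n 1, (fun i => Z i 0) ⬝ᵥ (fun i => Z i 0) = 1 := fun Z hZ => by
    have hZ : Zᵀ * Z = 1 := hZ
    rw [← hdot, hZ]; rfl
  have key : ∀ r : ℝ, 0 ≤ r → r < 1 →
      Real.arccos (r * (Xᵀ * c 1) 0 0) - Real.arccos (r * (Xᵀ * c 0) 0 0) ≤ curveLength β c := by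
    intro r hr0 hr1
    set f : Matrix (Fin n) (Fin 1) ℝ → ℝ := fun Z => Real.arccos (r * (Xᵀ * Z) 0 0) with hf
    have hcont : ∀ Z ∈ manifold n 1, ContinuousAt f Z := fun Z _ => by
      refine Continuous.continuousAt (Real.continuous_arccos.comp (continuous_const.mul ?_))
      exact (continuous_const.matrix_mul continuous_id).matrix_elem 0 0
    have hspeed : ∀ (c : ℝ → Matrix (Fin n) (Fin 1) ℝ) (ξ : Matrix (Fin n) (Fin 1) ℝ) (t : ℝ),
        (∀ᶠ s in nhds t, c s ∈ manifold n 1) → HasDerivAt c ξ t →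
        ∃ k, HasDerivAt (fun s => f (c s)) k t ∧ k ≤ √(metric β (c t) ξ ξ) := by
      intro c ξ t hm hd
      have hq : HasDerivAt (fun s => (Xᵀ * c s) 0 0) ((Xᵀ * ξ) 0 0) t := by
        simpa using hasDerivAt_matrix.1 (hasDerivAt_matrix_mul (hasDerivAt_const t Xᵀ) hd) 0 0
      have hξ := deriv_mem_tangentSpace hm hd
      have hct := hone _ hm.self_of_nhds
      have hX1 := hone _ (hγ.2.1 0)
      have hξ0 : 0 ≤ (ξᵀ * ξ) 0 0 := by
        rw [hdot]
        exact Finset.sum_nonneg fun i _ => mul_self_nonneg _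
      rw [metric_sphere β hξ]
      refine exists_hasDerivAt_arccos_mul hq hr0 hr1 (dotProduct_sq_le_one hX1 hct) ?_ hξ0
      refine dotProduct_sq_le hX1 hct ?_
      rw [← hdot, transpose_mul_eq_zero hξ]; rfl
    exact sub_le_curveLength hcont hspeed hc
  have hlim := le_of_forall_lt_one (F := fun r => Real.arccos (r * (Xᵀ * c 1) 0 0) -
    Real.arccos (r * (Xᵀ * c 0) 0 0)) (by fun_prop) key
  simp only [one_mul, hc0, hc1, hX, cos_of_isGeodesic_sphere hγ hs, Real.cos_pi] at hlim
  simpa using hlim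

end Sphere

/-! ### The unit normal of a hyperplane frame. -/

section Normal

variable {p : ℕ}

/-- The inclusion `ℝᵖ → ℝᵖ⁺¹` of the first `p` coordinates. -/
def initMatrix (p : ℕ) : Matrix (Fin (p + 1)) (Fin p) ℝ :=
  fun i j => if i = j.castSucc then 1 else 0

/-- The last basis vector of `ℝᵖ⁺¹`. -/
def lastMatrix (p : ℕ) : Matrix (Fin (p + 1)) (Fin 1) ℝ :=
  fun i _ => if i = Fin.last p then 1 else 0

/-- The unit normal of the hyperplane spanned by a `p`-frame in `ℝᵖ⁺¹`: the generalized cross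
product of the columns. -/
def normal (Z : Matrix (Fin (p + 1)) (Fin p) ℝ) : Matrix (Fin (p + 1)) (Fin 1) ℝ :=
  (Matrix.adjugate (Z * (initMatrix p)ᵀ))ᵀ * lastMatrix p

theorem init_transpose_mul_init : (initMatrix p)ᵀ * initMatrix p = 1 := by
  ext i j
  simp [Matrix.mul_apply, initMatrix, Matrix.one_apply, eq_comm]

theorem last_transpose_mul_init : (lastMatrix p)ᵀ * initMatrix p = 0 := by
  ext i j
  simp [Matrix.mul_apply, initMatrix, lastMatrix, Fin.castSucc_ne_last]

theorem init_mul_init_transpose : initMatrix p * (initMatrix p)ᵀ =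
    Matrix.diagonal fun i => if i = Fin.last p then 0 else 1 := by
  ext i j
  simp only [Matrix.mul_apply, initMatrix, Matrix.transpose_apply, Matrix.diagonal_apply]
  induction i using Fin.lastCases with
  | last => simp [(Fin.castSucc_ne_last _).symm]
  | cast i =>
    rw [Finset.sum_eq_single i]
    · simp [Fin.castSucc_ne_last, eq_comm]
    · intro k _ hk
      simp [hk.symm]
    · simp

theorem normal_transpose_mul (Z : Matrix (Fin (p + 1)) (Fin p) ℝ) : (normal Z)ᵀ * Z = 0 := by
  have h : Z = Z * (initMatrix p)ᵀ * initMatrix p := by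
    rw [Matrix.mul_assoc, init_transpose_mul_init, Matrix.mul_one]
  conv_lhs => arg 2; rw [h]
  rw [normal, Matrix.transpose_mul, Matrix.transpose_transpose, Matrix.mul_assoc,
    ← Matrix.mul_assoc (Matrix.adjugate _), Matrix.adjugate_mul, Matrix.smul_mul, Matrix.one_mul,
    Matrix.mul_smul, last_transpose_mul_init, smul_zero]

/-- For the square matrix `A = [Z 0]`, `Aᵀ A` is diagonal with ones and a final zero. Its adjugate
has a single one in the last corner, which is the squared length of the normal. -/
theorem normal_transpose_mul_normal {Z : Matrix (Fin (p + 1)) (Fin p) ℝ}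
    (hZ : Z ∈ manifold (p + 1) p) : (normal Z)ᵀ * normal Z = 1 := by
  have hZ : Zᵀ * Z = 1 := hZ
  have h : (Z * (initMatrix p)ᵀ)ᵀ * (Z * (initMatrix p)ᵀ) =
      Matrix.diagonal fun i => if i = Fin.last p then 0 else 1 := by
    rw [Matrix.transpose_mul, Matrix.transpose_transpose, Matrix.mul_assoc, ← Matrix.mul_assoc Zᵀ,
      hZ, Matrix.one_mul, init_mul_init_transpose]
  have h2 := congrArg Matrix.adjugate h
  rw [Matrix.adjugate_mul_distrib, ← Matrix.adjugate_transpose, Matrix.adjugate_diagonal] at h2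
  rw [normal, Matrix.transpose_mul, Matrix.transpose_transpose, Matrix.mul_assoc,
    ← Matrix.mul_assoc (Matrix.adjugate _), h2]
  ext i j
  rw [Subsingleton.elim i 0, Subsingleton.elim j 0]
  simp only [Matrix.mul_apply, Matrix.diagonal_apply, lastMatrix, Matrix.transpose_apply]
  simp only [ite_mul, zero_mul, one_mul, mul_ite, mul_one, mul_zero, Finset.sum_ite_eq', Finset.mem_univ, if_true, Matrix.one_apply_eq]
  refine Finset.prod_eq_one fun k hk => ?_
  rw [if_neg (Finset.ne_of_mem_erase hk)]

theorem mul_transpose_add_normal {Z : Matrix (Fin (p + 1)) (Fin p) ℝ}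
    (hZ : Z ∈ manifold (p + 1) p) : Z * Zᵀ + normal Z * (normal Z)ᵀ = 1 := by
  have hW := normal_transpose_mul Z
  have hW' : Zᵀ * normal Z = 0 := by simpa using congrArg Matrix.transpose hW
  have hZ' : Zᵀ * Z = 1 := hZ
  have h : (Matrix.fromCols Z (normal Z))ᵀ * Matrix.fromCols Z (normal Z) = 1 := by
    rw [Matrix.transpose_fromCols, Matrix.fromRows_mul_fromCols, hZ', hW, hW',
      normal_transpose_mul_normal hZ, Matrix.fromBlocks_one]
  have h' := (Matrix.mul_eq_one_comm_of_card_eq _ _ _ (by simp)).1 h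
  rwa [Matrix.transpose_fromCols, Matrix.fromCols_mul_fromRows] at h'

/-- Cofactors are polynomials in the entries. -/
theorem contDiff_normal : ContDiff ℝ 1 (normal (p := p)) := by
  rw [contDiff_matrix]
  intro i j
  simp only [normal, Matrix.mul_apply (M := (Matrix.adjugate _)ᵀ), Matrix.transpose_apply,
    Matrix.adjugate_apply, Matrix.det_apply]
  refine ContDiff.sum fun k _ => ContDiff.mul (ContDiff.sum fun σ _ => ContDiff.const_smul _
    (contDiff_prod fun a _ => ?_)) contDiff_const
  by_cases h : σ a = i
  · simp only [h, Matrix.updateRow_self]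
    exact contDiff_const
  · simp only [Matrix.updateRow_ne h, Matrix.mul_apply]
    exact ContDiff.sum fun l _ => (contDiff_entry _ _).mul contDiff_const

end Normal

/-! ### Spectral facts on skew-symmetric matrices. -/

section Spectral

variable {m : ℕ}

theorem trace_transpose_mul_self_nonneg (B : Matrix (Fin m) (Fin m) ℝ) : 0 ≤ (Bᵀ * B).trace :=
  Finset.sum_nonneg fun j _ => by
    rw [Matrix.diag_apply, Matrix.mul_apply]
    exact Finset.sum_nonneg fun i _ => mul_self_nonneg (B i j)

theorem dotProduct_mulVec_skew {M : Matrix (Fin m) (Fin m) ℝ} (hM : Mᵀ = -M) (u v : Fin m → ℝ) :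
    u ⬝ᵥ (M *ᵥ v) = -((M *ᵥ u) ⬝ᵥ v) := by
  rw [Matrix.dotProduct_mulVec, ← Matrix.mulVec_transpose, hM, Matrix.neg_mulVec, neg_dotProduct]

theorem dotProduct_mulVec_skew_self {M : Matrix (Fin m) (Fin m) ℝ} (hM : Mᵀ = -M)
    (u : Fin m → ℝ) : u ⬝ᵥ (M *ᵥ u) = 0 := by
  have h := dotProduct_mulVec_skew hM u u
  rw [dotProduct_comm (M *ᵥ u)] at h
  linarith

/-- The nonzero eigenvalues of a skew-symmetric matrix come in pairs. -/
theorem two_mul_norm_mulVec_skew_le {M : Matrix (Fin m) (Fin m) ℝ} (hM : Mᵀ = -M) {u : Fin m → ℝ}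
    (hu : u ⬝ᵥ u = 1) : 2 * ((M *ᵥ u) ⬝ᵥ (M *ᵥ u)) ≤ (Mᵀ * M).trace := by
  set y := M *ᵥ u with hy
  have huy : u ⬝ᵥ y = 0 := dotProduct_mulVec_skew_self hM u
  have hyu : y ⬝ᵥ u = 0 := by rw [dotProduct_comm, huy]
  have hMy : (M *ᵥ y) ⬝ᵥ u = -(y ⬝ᵥ y) := by
    rw [dotProduct_comm, dotProduct_mulVec_skew hM]
  -- `K` is skew and agrees with `M` on `u`. Since `y` is orthogonal to `u`, `⟨M, K⟩ = |K|² = 2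
  -- |y|²`, and `0 ≤ |M - K|²` gives the bound.
  set K := Matrix.vecMulVec y u - Matrix.vecMulVec u y with hK
  have hKs : Kᵀ = -K := by
    rw [hK, Matrix.transpose_sub, Matrix.transpose_vecMulVec, Matrix.transpose_vecMulVec, neg_sub]
  have h := trace_transpose_mul_self_nonneg (M - K)
  have hMK : (M * K).trace = -2 * (y ⬝ᵥ y) := by
    rw [hK, Matrix.mul_sub, Matrix.mul_vecMulVec, Matrix.mul_vecMulVec, Matrix.trace_sub,
      Matrix.trace_vecMulVec, Matrix.trace_vecMulVec, hMy, ← hy]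
    ring
  have hKK : (K * K).trace = -2 * (y ⬝ᵥ y) := by
    rw [hK]
    simp only [Matrix.sub_mul, Matrix.mul_sub, Matrix.vecMulVec_mul_vecMulVec, Matrix.trace_sub,
      Matrix.trace_vecMulVec, dotProduct_smul, hu, huy, hyu, smul_eq_mul]
    ring
  rw [Matrix.transpose_sub, hM, hKs] at h
  simp only [Matrix.sub_mul, Matrix.mul_sub, Matrix.neg_mul, Matrix.trace_sub, Matrix.trace_neg,
    Matrix.trace_mul_comm K M, hMK, hKK] at h
  rw [hM, Matrix.neg_mul, Matrix.trace_neg]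
  linarith

theorem exists_eigenbasis (M : Matrix (Fin m) (Fin m) ℝ) :
    ∃ (u : Fin m → Fin m → ℝ) (l : Fin m → ℝ), (∀ j, u j ⬝ᵥ u j = 1) ∧
      (∀ j, (Mᵀ * M) *ᵥ u j = l j • u j) ∧
      ∀ B : Matrix (Fin m) (Fin m) ℝ, ∑ j, (B *ᵥ u j) ⬝ᵥ (B *ᵥ u j) = (Bᵀ * B).trace := by
  have hA : (Mᵀ * M).IsHermitian := by
    rw [← Matrix.conjTranspose_eq_transpose_of_trivial]
    exact Matrix.isHermitian_conjTranspose_mul_self M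
  set U : Matrix (Fin m) (Fin m) ℝ := hA.eigenvectorUnitary.1 with hU
  have hUU : U * Uᵀ = 1 := by
    have := (Matrix.mem_unitaryGroup_iff).1 hA.eigenvectorUnitary.2
    rwa [Matrix.star_eq_conjTranspose, Matrix.conjTranspose_eq_transpose_of_trivial] at this
  have hUU' : Uᵀ * U = 1 := mul_eq_one_comm.1 hUU
  refine ⟨fun j i => U i j, hA.eigenvalues, fun j => ?_, fun j => ?_, fun B => ?_⟩
  · change (Uᵀ * U) j j = 1
    rw [hUU', Matrix.one_apply_eq]
  · exact hA.mulVec_eigenvectorBasis j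
  · change ((B * U)ᵀ * (B * U)).trace = _
    rw [Matrix.transpose_mul, Matrix.mul_assoc, Matrix.trace_mul_comm, Matrix.mul_assoc,
      Matrix.mul_assoc, hUU, Matrix.mul_one]

end Spectral

theorem hasDerivAt_dotProduct_mulVec {m : ℕ} (u v : Fin m → ℝ)
    {F : ℝ → Matrix (Fin m) (Fin m) ℝ} {F' : Matrix (Fin m) (Fin m) ℝ} {t : ℝ}
    (hF : HasDerivAt F F' t) :
    HasDerivAt (fun s => u ⬝ᵥ (F s *ᵥ v)) (u ⬝ᵥ (F' *ᵥ v)) t := by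
  rw [hasDerivAt_matrix] at hF
  simp only [Matrix.mulVec, dotProduct]
  exact HasDerivAt.fun_sum fun i _ =>
    (HasDerivAt.fun_sum fun j _ => (hF i j).mul_const (v j)).const_mul (u i)

/-! ### Lower bound for `p = n - 1` through the rotation group. -/

section Hyperplane

variable {p : ℕ}

/-- The rotation that maps the frame `X` to the frame `Z` of hyperplanes in `ℝᵖ⁺¹`. -/
def rotation (X Z : Matrix (Fin (p + 1)) (Fin p) ℝ) : Matrix (Fin (p + 1)) (Fin (p + 1)) ℝ :=
  Z * Xᵀ + normal Z * (normal X)ᵀ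

theorem rotation_self {X : Matrix (Fin (p + 1)) (Fin p) ℝ} (hX : X ∈ manifold (p + 1) p) :
    rotation X X = 1 :=
  mul_transpose_add_normal hX

theorem rotation_orthogonal {X Z : Matrix (Fin (p + 1)) (Fin p) ℝ} (hX : X ∈ manifold (p + 1) p)
    (hZ : Z ∈ manifold (p + 1) p) : (rotation X Z)ᵀ * rotation X Z = 1 := by
  have hZ' : Zᵀ * Z = 1 := hZ
  have hW := normal_transpose_mul Z
  have hW' : Zᵀ * normal Z = 0 := by simpa using congrArg Matrix.transpose hW
  rw [← mul_transpose_add_normal hX]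
  simp only [rotation, Matrix.transpose_add, Matrix.transpose_mul, Matrix.transpose_transpose,
    Matrix.mul_add, Matrix.add_mul, Matrix.mul_assoc]
  rw [← Matrix.mul_assoc Zᵀ, ← Matrix.mul_assoc Zᵀ, ← Matrix.mul_assoc (normal Z)ᵀ,
    ← Matrix.mul_assoc (normal Z)ᵀ, hZ', hW, hW', normal_transpose_mul_normal hZ]
  simp

/-- The momentum is the angular velocity: differentiating the orthonormality relations of frame and
normal shows that it also moves the normal. -/
theorem hasDerivAt_rotation (X : Matrix (Fin (p + 1)) (Fin p) ℝ)
    {c : ℝ → Matrix (Fin (p + 1)) (Fin p) ℝ} {ξ : Matrix (Fin (p + 1)) (Fin p) ℝ} {t : ℝ}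
    (hm : ∀ᶠ s in nhds t, c s ∈ manifold (p + 1) p) (hd : HasDerivAt c ξ t) :
    HasDerivAt (fun s => rotation X (c s)) (momentum (c t) ξ * rotation X (c t)) t := by
  have hct := hm.self_of_nhds
  have hξ := deriv_mem_tangentSpace hm hd
  obtain ⟨w, hw⟩ : ∃ w, HasDerivAt (fun s => normal (c s)) w t :=
    ⟨_, ((contDiff_normal.differentiable one_ne_zero) (c t)).hasFDerivAt.comp_hasDerivAt t hd⟩
  have h1 : wᵀ * c t + (normal (c t))ᵀ * ξ = 0 := by
    refine (hasDerivAt_matrix_mul (hasDerivAt_matrix_transpose hw) hd).unique ?_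
    simp only [normal_transpose_mul]
    exact hasDerivAt_const t _
  have h2 : wᵀ * normal (c t) + (normal (c t))ᵀ * w = 0 := by
    refine (hasDerivAt_matrix_mul (hasDerivAt_matrix_transpose hw) hw).unique ?_
    refine (hasDerivAt_const t (1 : Matrix (Fin 1) (Fin 1) ℝ)).congr_of_eventuallyEq ?_
    filter_upwards [hm] with s hs using normal_transpose_mul_normal hs
  have h3 : (normal (c t))ᵀ * w = 0 := by
    rw [add_comm] at h2
    exact transpose_mul_eq_zero h2
  have h4 : (c t)ᵀ * w = -(ξᵀ * normal (c t)) := by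
    have := congrArg Matrix.transpose h1
    simp only [Matrix.transpose_add, Matrix.transpose_mul, Matrix.transpose_transpose,
      Matrix.transpose_zero] at this
    exact eq_neg_of_add_eq_zero_left this
  have h5 : w = momentum (c t) ξ * normal (c t) := by
    have hn : (c t)ᵀ * normal (c t) = 0 := by
      simpa using congrArg Matrix.transpose (normal_transpose_mul (c t))
    calc w = (c t * (c t)ᵀ + normal (c t) * (normal (c t))ᵀ) * w := by
          rw [mul_transpose_add_normal hct, Matrix.one_mul]
      _ = -(c t * (ξᵀ * normal (c t))) := by
          rw [Matrix.add_mul, Matrix.mul_assoc, Matrix.mul_assoc, h3, h4, Matrix.mul_zero, add_zero,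
            Matrix.mul_neg]
      _ = _ := by
          simp only [momentum, Matrix.add_mul, Matrix.sub_mul, Matrix.mul_assoc, hn,
            Matrix.mul_zero, zero_sub, add_zero]
  have h6 := (hasDerivAt_matrix_mul hd (hasDerivAt_const t Xᵀ)).add
    (hasDerivAt_matrix_mul hw (hasDerivAt_const t (normal X)ᵀ))
  refine HasDerivAt.congr_deriv h6 ?_
  simp only [rotation, Matrix.mul_zero, add_zero]
  rw [Matrix.mul_add, ← Matrix.mul_assoc, ← Matrix.mul_assoc, momentum_mul hct, ← h5]

/-- The rotation solves `S'' = M² S`, and `M² u = -μ² u` because `M` is skew; so the coefficient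
satisfies the harmonic oscillator equation. -/
theorem rotation_of_isGeodesic {γ : ℝ → Matrix (Fin (p + 1)) (Fin p) ℝ}
    (hγ : IsGeodesic (1 / 2) γ) {u : Fin (p + 1) → ℝ} (hu : u ⬝ᵥ u = 1) {μ : ℝ}
    (hμ : ((momentum (γ 0) (deriv γ 0))ᵀ * momentum (γ 0) (deriv γ 0)) *ᵥ u = μ ^ 2 • u) (t : ℝ) :
    u ⬝ᵥ (rotation (γ 0) (γ t) *ᵥ u) = Real.cos (μ * t) := by
  set M := momentum (γ 0) (deriv γ 0) with hM
  have hskew : Mᵀ = -M := momentum_skew (hγ.velocity_mem 0)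
  have hS : ∀ t, HasDerivAt (fun s => rotation (γ 0) (γ s)) (M * rotation (γ 0) (γ t)) t :=
    fun t => by
      have := hasDerivAt_rotation (γ 0) (Filter.Eventually.of_forall hγ.2.1)
        (matrix_hasDerivAt_deriv hγ.1 t)
      rwa [hγ.momentum_eq t] at this
  have hy := fun t => hasDerivAt_dotProduct_mulVec u u (hS t)
  have hz : ∀ t, HasDerivAt (fun t => u ⬝ᵥ ((M * rotation (γ 0) (γ t)) *ᵥ u))
      (-μ ^ 2 * (u ⬝ᵥ (rotation (γ 0) (γ t) *ᵥ u))) t := fun t => by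
    have h := hasDerivAt_dotProduct_mulVec u u
      (hasDerivAt_matrix_mul (hasDerivAt_const t M) (hS t))
    refine HasDerivAt.congr_deriv h ?_
    rw [Matrix.zero_mul, zero_add, ← Matrix.mulVec_mulVec, ← Matrix.mulVec_mulVec,
      dotProduct_mulVec_skew hskew, dotProduct_mulVec_skew hskew, neg_neg, Matrix.mulVec_mulVec]
    rw [hskew, Matrix.neg_mul, Matrix.neg_mulVec] at hμ
    rw [neg_eq_iff_eq_neg.1 hμ, neg_dotProduct, smul_dotProduct, smul_eq_mul, neg_mul]
  refine eq_cos_of_hasDerivAt hy hz ?_ ?_ t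
  · rw [rotation_self (hγ.2.1 0), Matrix.one_mulVec, hu]
  · rw [rotation_self (hγ.2.1 0), Matrix.mul_one, dotProduct_mulVec_skew_self hskew]

/-- A weighted sum of smoothed spherical distances, for an orthonormal basis `u`, does not grow
faster than the arc length of the canonical metric. -/
theorem exists_hasDerivAt_sum_arccos {X : Matrix (Fin (p + 1)) (Fin p) ℝ}
    (hX : X ∈ manifold (p + 1) p) {u : Fin (p + 1) → Fin (p + 1) → ℝ}
    (hu : ∀ j, u j ⬝ᵥ u j = 1)
    (htr : ∀ B : Matrix (Fin (p + 1)) (Fin (p + 1)) ℝ,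
      ∑ j, (B *ᵥ u j) ⬝ᵥ (B *ᵥ u j) = (Bᵀ * B).trace)
    {a : Fin (p + 1) → ℝ} (ha0 : ∀ j, 0 ≤ a j) (ha : ∑ j, a j ^ 2 = 1 / 2) {r : ℝ} (hr0 : 0 ≤ r)
    (hr1 : r < 1) (c : ℝ → Matrix (Fin (p + 1)) (Fin p) ℝ) (ξ : Matrix (Fin (p + 1)) (Fin p) ℝ)
    (t : ℝ) (hm : ∀ᶠ s in nhds t, c s ∈ manifold (p + 1) p) (hd : HasDerivAt c ξ t) :
    ∃ k, HasDerivAt (fun s => ∑ j, a j * Real.arccos (r * (u j ⬝ᵥ (rotation X (c s) *ᵥ u j)))) k t ∧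
      k ≤ √(metric (1 / 2) (c t) ξ ξ) := by
  have hct := hm.self_of_nhds
  have hξ := deriv_mem_tangentSpace hm hd
  set M := momentum (c t) ξ with hM
  have hskew : Mᵀ = -M := momentum_skew hξ
  set S := rotation X (c t) with hS
  have hSS : Sᵀ * S = 1 := rotation_orthogonal hX hct
  have hSd := hasDerivAt_rotation X hm hd
  have hunit : ∀ j, (S *ᵥ u j) ⬝ᵥ (S *ᵥ u j) = 1 := fun j => by
    rw [Matrix.dotProduct_mulVec, ← Matrix.mulVec_transpose, Matrix.mulVec_mulVec, hSS,
      Matrix.one_mulVec, hu]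
  have hk : ∀ j, ∃ k, HasDerivAt (fun s => Real.arccos (r * (u j ⬝ᵥ (rotation X (c s) *ᵥ u j)))) k t ∧
      k ≤ √(((M * S) *ᵥ u j) ⬝ᵥ ((M * S) *ᵥ u j)) := fun j => by
    refine exists_hasDerivAt_arccos_mul (hasDerivAt_dotProduct_mulVec (u j) (u j) hSd) hr0 hr1
      (dotProduct_sq_le_one (hu j) (hunit j)) (dotProduct_sq_le (hu j) (hunit j) ?_)
      (Finset.sum_nonneg fun _ _ => mul_self_nonneg _)
    rw [← Matrix.mulVec_mulVec]
    exact dotProduct_mulVec_skew_self hskew _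
  choose k hk1 hk2 using hk
  refine ⟨∑ j, a j * k j, HasDerivAt.fun_sum fun j _ => (hk1 j).const_mul (a j), ?_⟩
  have hsum : ∑ j, ((M * S) *ᵥ u j) ⬝ᵥ ((M * S) *ᵥ u j) = 2 * metric (1 / 2) (c t) ξ ξ := by
    rw [htr, Matrix.transpose_mul, Matrix.mul_assoc, Matrix.trace_mul_comm, Matrix.mul_assoc,
      Matrix.mul_assoc, mul_eq_one_comm.1 hSS, Matrix.mul_one, trace_momentum hct hξ]
  calc ∑ j, a j * k j ≤ ∑ j, a j * √(((M * S) *ᵥ u j) ⬝ᵥ ((M * S) *ᵥ u j)) :=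
        Finset.sum_le_sum fun j _ => mul_le_mul_of_nonneg_left (hk2 j) (ha0 j)
    _ ≤ √(∑ j, a j ^ 2) * √(∑ j, √(((M * S) *ᵥ u j) ⬝ᵥ ((M * S) *ᵥ u j)) ^ 2) :=
        Real.sum_mul_le_sqrt_mul_sqrt _ _ _
    _ = √(metric (1 / 2) (c t) ξ ξ) := by
        have : ∀ j, √(((M * S) *ᵥ u j) ⬝ᵥ ((M * S) *ᵥ u j)) ^ 2 =
            ((M * S) *ᵥ u j) ⬝ᵥ ((M * S) *ᵥ u j) := fun j =>
          Real.sq_sqrt (Finset.sum_nonneg fun _ _ => mul_self_nonneg _)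
        simp only [this]
        rw [hsum, ha, ← Real.sqrt_mul (by norm_num)]
        congr 1
        ring

theorem pi_le_injRadius_hyperplane : ENNReal.ofReal Real.pi ≤ injRadius (1 / 2) (p + 1) p := by
  refine le_injRadius fun γ hγ _ hs0 =>
    le_cutTime hγ (hγ.metric_eq_one hs0) Real.pi_pos fun c hc hc0 hc1 => ?_
  have hX := hγ.2.1 0
  have hskew := momentum_skew (hγ.velocity_mem 0)
  have hT := trace_momentum hX (hγ.velocity_mem 0)
  rw [hs0, mul_one] at hT
  obtain ⟨u, l, hu, hl, htr⟩ := exists_eigenbasis (momentum (γ 0) (deriv γ 0))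
  set M := momentum (γ 0) (deriv γ 0) with hM
  have hlM : ∀ j, l j = (M *ᵥ u j) ⬝ᵥ (M *ᵥ u j) := fun j => by
    have := congrArg (fun v => u j ⬝ᵥ v) (hl j)
    simp only [dotProduct_smul, hu, smul_eq_mul, mul_one] at this
    rw [← this, Matrix.dotProduct_mulVec (M *ᵥ u j), ← Matrix.mulVec_transpose,
      Matrix.mulVec_mulVec, dotProduct_comm]
  have hl0 : ∀ j, 0 ≤ l j := fun j => by
    rw [hlM]; exact Finset.sum_nonneg fun _ _ => mul_self_nonneg _
  have hl1 : ∀ j, √(l j) ≤ 1 := fun j => by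
    have := two_mul_norm_mulVec_skew_le hskew (hu j)
    rw [hT, ← hlM] at this
    exact Real.sqrt_le_one.2 (by linarith)
  have hlsum : ∑ j, l j = 2 := by
    rw [← hT, ← htr M]
    exact Finset.sum_congr rfl fun j _ => hlM j
  have hcos : ∀ j t, u j ⬝ᵥ (rotation (γ 0) (γ t) *ᵥ u j) = Real.cos (√(l j) * t) := fun j t =>
    rotation_of_isGeodesic hγ (hu j) (by rw [Real.sq_sqrt (hl0 j)]; exact hl j) t
  -- This normalization cancels the factor `2` between squared angular velocity and canonical metric
  -- in the Cauchy–Schwarz bound.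
  have ha : ∑ j, (√(l j) / 2) ^ 2 = 1 / 2 := by
    simp only [div_pow, Real.sq_sqrt (hl0 _), ← Finset.sum_div, hlsum]
    norm_num
  have key : ∀ r : ℝ, 0 ≤ r → r < 1 →
      ∑ j, √(l j) / 2 * Real.arccos (r * Real.cos (√(l j) * Real.pi)) -
        ∑ j, √(l j) / 2 * Real.arccos (r * Real.cos (√(l j) * 0)) ≤ curveLength (1 / 2) c := by
    intro r hr0 hr1
    set f : Matrix (Fin (p + 1)) (Fin p) ℝ → ℝ := fun Z =>
      ∑ j, √(l j) / 2 * Real.arccos (r * (u j ⬝ᵥ (rotation (γ 0) Z *ᵥ u j))) with hf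
    have hcont : ∀ Z ∈ manifold (p + 1) p, ContinuousAt f Z := fun Z _ => by
      have hR : Continuous (rotation (γ 0)) :=
        (continuous_id.matrix_mul continuous_const).add
          (contDiff_normal.continuous.matrix_mul continuous_const)
      refine Continuous.continuousAt (continuous_finsetSum _ fun j _ => continuous_const.mul
        (Real.continuous_arccos.comp (continuous_const.mul ?_)))
      exact continuous_const.dotProduct (hR.matrix_mulVec continuous_const)
    have h := sub_le_curveLength hcont (exists_hasDerivAt_sum_arccos hX hu htr
      (fun j => div_nonneg (Real.sqrt_nonneg _) zero_le_two) ha hr0 hr1) hc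
    rw [hc0, hc1] at h
    simpa only [hf, hcos] using h
  have hlim := le_of_forall_lt_one (F := fun r =>
    ∑ j, √(l j) / 2 * Real.arccos (r * Real.cos (√(l j) * Real.pi)) -
      ∑ j, √(l j) / 2 * Real.arccos (r * Real.cos (√(l j) * 0))) (by fun_prop) key
  -- The pairing of singular values is needed here: `√(l j) ≤ 1` keeps each angle within `[0, π]`.
  have hpi : ∀ j, Real.arccos (Real.cos (√(l j) * Real.pi)) = √(l j) * Real.pi := fun j =>
    Real.arccos_cos (by positivity) (by nlinarith [hl1 j, Real.pi_pos])
  simp only [one_mul, hpi, mul_zero, Real.cos_zero, Real.arccos_one, Finset.sum_const_zero,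
    sub_zero] at hlim
  have e : ∑ j, √(l j) / 2 * (√(l j) * Real.pi) = Real.pi := by
    have : ∀ j, √(l j) / 2 * (√(l j) * Real.pi) = l j * (Real.pi / 2) := fun j => by
      have := Real.mul_self_sqrt (hl0 j)
      linear_combination Real.pi / 2 * this
    simp only [this, ← Finset.sum_mul, hlsum]
    ring
  linarith

end Hyperplane

end Stiefel

theorem corollary7p2 :
    (∃ tr : ℝ, IsLeast {t : ℝ | 0 < t ∧ Real.sin t / t + Real.cos t = 0} tr ∧
      |tr * √2 / Real.pi - 0.91326189159122| ≤ 5 / 10 ^ 15 ∧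
      ∀ n p : ℕ, 2 ≤ p → p + 2 ≤ n →
        Stiefel.injRadius (1 / 2) n p ≤ ENNReal.ofReal (tr * √2)) ∧
    (∀ n p : ℕ, 2 ≤ p → p + 2 ≤ n → Stiefel.injRadius 1 n p ≤ ENNReal.ofReal Real.pi) ∧
    (∀ n p : ℕ, 1 ≤ p → n = p + 1 →
      Stiefel.injRadius (1 / 2) n p = ENNReal.ofReal Real.pi ∧
      Stiefel.injRadius 1 n p ≤ ENNReal.ofReal Real.pi) ∧
    (∀ β : ℝ, 0 < β → ∀ n : ℕ, 2 ≤ n →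
      Stiefel.injRadius β n 1 = ENNReal.ofReal Real.pi) := by
  refine ⟨?_, fun n p hp hn => Stiefel.injRadius_le_pi (by omega) (by omega) 1, ?_, ?_⟩
  · obtain ⟨τ, h1, h2, h0, hpos, hneg⟩ := Stiefel.exists_conjFun_root
    have hτ : 0 < τ := by linarith
    have hτπ : τ < Real.pi := by linarith [Real.pi_gt_three]
    exact ⟨τ, Stiefel.isLeast_of_conjFun_root hτ h0 hpos, Stiefel.approx_of_mem h1 h2,
      fun n p hp hn => Stiefel.injRadius_canonical_le hp hn hτ hτπ hneg⟩
  · rintro n p hp rfl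
    exact ⟨le_antisymm (Stiefel.injRadius_le_pi hp le_rfl _) Stiefel.pi_le_injRadius_hyperplane,
      Stiefel.injRadius_le_pi hp le_rfl 1⟩
  · exact fun β _ n hn => le_antisymm (Stiefel.injRadius_le_pi le_rfl hn β)
      (Stiefel.pi_le_injRadius_sphere β)
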